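/- For every integer $M\ge 0$ there is a finite constant $C\ge 0$, depending only on $M$, such that the following holds. Let $p\ge M$, let $\boldsymbol z\sim N(\boldsymbol 0_p,\boldsymbol I_p)$ be a random vector on some probability space, and let $\boldsymbol W:\mathbb R^p\to\mathbb R^{p\times M}$ be locally Lipschitz. Then there is a random vector $\boldsymbol g\sim N(\boldsymbol 0_M,\boldsymbol I_M)$ on the same probability space such that $$ \mathbb E\Bigl[\Bigl\|\boldsymbol W(\boldsymbol z)^\top\boldsymbol z-\sum_{j=1}^p\frac{\partial\, \boldsymbol W(\boldsymbol z)^\top\boldsymbol e_j}{\partial z_j}-\bigl\{\boldsymbol W(\boldsymbol z)^\top\boldsymbol W(\boldsymbol z)\bigr\}^{1/2}\boldsymbol g\Bigr\|^2\Bigr]\le C\sum_{j=1}^p\mathbb E\Bigl[\Bigl\|\frac{\partial \boldsymbol W(\boldsymbol z)}{\partial z_j}\Bigr\|_F^2\Bigr]. $$ Here $\|\cdot\|$ is the Euclidean norm, $\|\cdot\|_F$ the Frobenius norm, $\boldsymbol e_j$ the $j$-th canonical basis vector of $\mathbb R^p$, $\{\cdot\}^{1/2}$ the positive semidefinite square root,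 and the partial derivatives are the pointwise ones, which exist almost everywhere. Both expectations are of nonnegative random variables and take values in $[0,\infty]$. -/

import Mathlib

open MeasureTheory ProbabilityTheory
open scoped NNReal ENNReal Matrix MatrixOrder Matrix.Norms.Frobenius

noncomputable section

/-- The partial derivative `∂F/∂z_j` of a map `F` on `ℝ^p`, in the classical pointwise sense. -/
def partialDeriv {p : ℕ} {V : Type*} [NormedAddCommGroup V] [NormedSpace ℝ V]
    (F : EuclideanSpace ℝ (Fin p) → V) (j : Fin p) (z : EuclideanSpace ℝ (Fin p)) : V :=
  lineDeriv ℝ F z (EuclideanSpace.single j 1)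

/-- The vector `∑_j ∂(W(z)ᵀ e_j)/∂z_j` in `ℝ^M` of a matrix field `W` on `ℝ^p`. -/
def matrixFieldDiv {p M : ℕ} (W : EuclideanSpace ℝ (Fin p) → Matrix (Fin p) (Fin M) ℝ)
    (z : EuclideanSpace ℝ (Fin p)) : EuclideanSpace ℝ (Fin M) :=
  ∑ j, partialDeriv
    (fun x => Matrix.toEuclideanLin (W x)ᵀ (EuclideanSpace.single j (1 : ℝ))) j z

end

open Set Filter Topology Module Metric
open scoped RealInnerProductSpace

/-! ### Locally Lipschitz functions and Rademacher's theorem. -/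

section LocallyLipschitz

variable {E F : Type*} [NormedAddCommGroup E]

/-! Compare `W` with a constant matrix `A = W y`. By the Gaussian Poincaré inequality
(`lintegral_lintegral_enorm_sub_sq_le`), `y` can be chosen so that `E‖W(z) - A‖²` is at most three
times the Dirichlet energy (`exists_sum_lintegral_sub_le`).

For constant `A` the approximation is exact. Since `M ≤ p`, polar decomposition gives `Aᵀ z =
(AᵀA)^{1/2} g` with `g = ∑ ⟪q j, z⟫ v j`, and orthonormality of `q` and `v` makes `g` standard
Gaussian. Hence the error at `W` is `[(W - A)ᵀ z - div (W - A)] - [(WᵀW)^{1/2} - (AᵀA)^{1/2}] g`.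

The first bracket is a Gaussian divergence; the second order Stein formula bounds its second moment
by those of `W - A` and its gradient (`lintegral_sum_gaussianDiv_le`). For the second, `A ↦
(AᵀA)^{1/2}` is Lipschitz with a constant depending on `M` only (`Matrix.norm_sqrt_sub_sqrt_sq_le`),
and Stein's identity controls the weight `‖g‖²`, which depends on `z`
(`lintegral_enorm_sq_mul_inner_le`). Integrations by parts are done for compactly supported
functions; cutoffs and Fatou's lemma remove the restriction. -/

theorem LocallyLipschitz.real_mul {f g : E → ℝ} (hf : LocallyLipschitz f)
    (hg : LocallyLipschitz g) : LocallyLipschitz fun x => f x * g x :=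
  (contDiff_mul (𝕜 := ℝ) (n := 1)).locallyLipschitz.comp (hf.prodMk hg)

theorem LocallyLipschitz.clm_comp {F G : Type*} [NormedAddCommGroup F] [NormedSpace ℝ F]
    [NormedAddCommGroup G] [NormedSpace ℝ G] (L : F →L[ℝ] G) {f : E → F}
    (hf : LocallyLipschitz f) : LocallyLipschitz fun x => L (f x) :=
  L.lipschitz.locallyLipschitz.comp hf

variable [NormedSpace ℝ E] [FiniteDimensional ℝ E]

theorem LocallyLipschitz.lipschitzWith_of_hasCompactSupport {f : E → ℝ}
    (hf : LocallyLipschitz f) (hc : HasCompactSupport f) : ∃ K, LipschitzWith K f := by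
  have hcomp : IsCompact (cthickening 1 (tsupport f)) := hc.isCompact.cthickening
  obtain ⟨K, hK⟩ := hf.locallyLipschitzOn.exists_lipschitzOnWith_of_compact hcomp
  obtain ⟨B, hB⟩ := hc.exists_bound_of_continuous hf.continuous
  have hB0 : 0 ≤ B := (norm_nonneg _).trans (hB 0)
  refine ⟨K + B.toNNReal, LipschitzWith.of_dist_le_mul fun x y => ?_⟩
  -- Points within distance 1 of the support lie in a compact set, where `K` serves; a pair at
  -- distance more than 1 is handled by the sup bound `B`.
  have key : ∀ a b, a ∈ tsupport f → dist (f a) (f b) ≤ (K + B) * dist a b := by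
    intro a b ha
    by_cases hb : b ∈ cthickening 1 (tsupport f)
    · have := hK.dist_le_mul a (self_subset_cthickening _ ha) b hb
      nlinarith [dist_nonneg (x := a) (y := b)]
    · have h0 : f b = 0 := by
        by_contra h
        exact hb (self_subset_cthickening _ (subset_tsupport _ h))
      have h1 : 1 < dist a b := by
        by_contra! h
        exact hb (mem_cthickening_of_dist_le b a 1 _ ha (by rwa [dist_comm]))
      have h2 : dist (f a) (f b) ≤ B := by simpa [h0] using hB a
      have h3 : 0 ≤ (K : ℝ) := K.2
      nlinarith
  have hKB : ((K + B.toNNReal : ℝ≥0) : ℝ) = K + B := by simp [hB0]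
  rw [hKB]
  by_cases hx : x ∈ tsupport f
  · exact key x y hx
  by_cases hy : y ∈ tsupport f
  · rw [dist_comm, dist_comm x]
    exact key y x hy
  · rw [image_eq_zero_of_notMem_tsupport hx, image_eq_zero_of_notMem_tsupport hy, dist_self]
    have h3 : 0 ≤ (K : ℝ) := K.2
    positivity

theorem LocallyLipschitz.ae_differentiableAt [NormedAddCommGroup F] [NormedSpace ℝ F]
    [FiniteDimensional ℝ F] [MeasurableSpace E] [BorelSpace E] {f : E → F}
    (hf : LocallyLipschitz f) (μ : Measure E) [μ.IsAddHaarMeasure] :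
    ∀ᵐ x ∂μ, DifferentiableAt ℝ f x := by
  have hloc : ∀ n : ℕ, ∀ᵐ x ∂μ, x ∈ ball (0 : E) n → DifferentiableAt ℝ f x := by
    intro n
    obtain ⟨K, hK⟩ := hf.locallyLipschitzOn.exists_lipschitzOnWith_of_compact
      (isCompact_closedBall (0 : E) n)
    filter_upwards [(hK.mono ball_subset_closedBall).ae_differentiableWithinAt_of_mem (μ := μ)]
      with x hx hmem
    exact (hx hmem).differentiableAt (isOpen_ball.mem_nhds hmem)
  filter_upwards [ae_all_iff.2 hloc] with x hx
  obtain ⟨n, hn⟩ := exists_nat_gt ‖x‖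
  exact hx n (by simpa using hn)

end LocallyLipschitz

/-! ### Lebesgue density of the standard Gaussian. -/

section Density

variable (E : Type*) [NormedAddCommGroup E] [InnerProductSpace ℝ E]

/-- The Lebesgue density of the standard Gaussian measure. -/
noncomputable def gaussianDensity (x : E) : ℝ :=
  ((2 * Real.pi) ^ (finrank ℝ E / 2 : ℝ))⁻¹ * Real.exp (-(1 / 2) * ‖x‖ ^ 2)

theorem contDiff_gaussianDensity : ContDiff ℝ 1 (gaussianDensity E) := by
  unfold gaussianDensity
  exact contDiff_const.mul ((contDiff_const.mul (contDiff_norm_sq ℝ)).exp)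

theorem gaussianDensity_pos (x : E) : 0 < gaussianDensity E x := by
  unfold gaussianDensity
  positivity

theorem lineDeriv_gaussianDensity (x v : E) :
    lineDeriv ℝ (gaussianDensity E) x v = -(⟪v, x⟫ * gaussianDensity E x) := by
  have h : HasFDerivAt (gaussianDensity E) (((2 * Real.pi) ^ (finrank ℝ E / 2 : ℝ))⁻¹ •
      (Real.exp (-(1 / 2) * ‖x‖ ^ 2) • ((-(1 / 2) : ℝ) • (2 • (innerSL ℝ x))))) x := by
    unfold gaussianDensity
    exact ((((hasStrictFDerivAt_norm_sq x).hasFDerivAt.const_mul (-(1 / 2) : ℝ)).exp).const_mul _)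
  rw [(h.hasLineDerivAt v).lineDeriv]
  simp [gaussianDensity, real_inner_comm x v]
  ring

variable [FiniteDimensional ℝ E] [MeasurableSpace E] [BorelSpace E]

/-- Both measures are finite and have the same characteristic function, by the Fourier transform of
`exp (-‖x‖² / 2)`. -/
theorem stdGaussian_eq_withDensity :
    stdGaussian E = (volume : Measure E).withDensity
      (fun x => ENNReal.ofReal (gaussianDensity E x)) := by
  have hcont : Continuous (gaussianDensity E) := (contDiff_gaussianDensity E).continuous
  have hint : Integrable (gaussianDensity E) := by
    have := GaussianFourier.integrable_cexp_neg_mul_sq_norm_add (V := E) (b := 1 / 2)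
      (by norm_num) 0 0
    refine ((this.norm.const_mul (((2 * Real.pi) ^ (finrank ℝ E / 2 : ℝ))⁻¹))).congr ?_
    filter_upwards with x
    simp [gaussianDensity, Complex.norm_exp, ← Complex.ofReal_pow]
  have hfin : IsFiniteMeasure ((volume : Measure E).withDensity
      (fun x => ENNReal.ofReal (gaussianDensity E x))) :=
    isFiniteMeasure_withDensity_ofReal hint.2
  refine Measure.ext_of_charFun (funext fun t => ?_)
  rw [charFun_stdGaussian, charFun_apply,
    integral_withDensity_eq_integral_toReal_smul (by fun_prop) (by simp)]
  have h := GaussianFourier.integral_cexp_neg_mul_sq_norm_add (V := E) (b := 1 / 2)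
    (by norm_num) Complex.I t
  have h2 : ∀ x : E, (ENNReal.ofReal (gaussianDensity E x)).toReal •
      Complex.exp (⟪x, t⟫ * Complex.I) = (((2 * Real.pi) ^ (finrank ℝ E / 2 : ℝ))⁻¹ : ℝ) *
        Complex.exp (-(1 / 2 : ℂ) * ‖x‖ ^ 2 + Complex.I * ⟪t, x⟫) := by
    intro x
    rw [ENNReal.toReal_ofReal (gaussianDensity_pos E x).le, gaussianDensity, Complex.exp_add,
      real_inner_comm, Complex.real_smul]
    push_cast
    rw [mul_comm Complex.I]
    ring
  simp_rw [h2]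
  rw [integral_const_mul, h, ← mul_assoc]
  have h3 : ((((2 * Real.pi) ^ (finrank ℝ E / 2 : ℝ))⁻¹ : ℝ) : ℂ) *
      ((Real.pi : ℂ) / (1 / 2 : ℂ)) ^ (finrank ℝ E / 2 : ℂ) = 1 := by
    have : (Real.pi : ℂ) / (1 / 2 : ℂ) = ((2 * Real.pi : ℝ) : ℂ) := by push_cast; ring
    rw [this]
    have h4 : ((2 * Real.pi : ℝ) : ℂ) ^ (finrank ℝ E / 2 : ℂ) =
        (((2 * Real.pi) ^ (finrank ℝ E / 2 : ℝ) : ℝ) : ℂ) := by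
      rw [Complex.ofReal_cpow (by positivity)]
      push_cast
      rfl
    rw [h4, ← Complex.ofReal_mul, inv_mul_cancel₀ (by positivity), Complex.ofReal_one]
  rw [h3, one_mul]
  congr 1
  rw [Complex.I_sq]
  ring

theorem stdGaussian_absolutelyContinuous : stdGaussian E ≪ (volume : Measure E) := by
  rw [stdGaussian_eq_withDensity]
  exact withDensity_absolutelyContinuous _ _

variable {E}

theorem integral_stdGaussian_eq_integral_density (f : E → ℝ) :
    ∫ x, f x ∂(stdGaussian E) = ∫ x, gaussianDensity E x * f x := by
  have hcont : Continuous (gaussianDensity E) := (contDiff_gaussianDensity E).continuous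
  rw [stdGaussian_eq_withDensity,
    integral_withDensity_eq_integral_toReal_smul (by fun_prop) (by simp)]
  simp [ENNReal.toReal_ofReal (gaussianDensity_pos E _).le]

theorem LocallyLipschitz.ae_differentiableAt_stdGaussian {F : Type*} [NormedAddCommGroup F]
    [NormedSpace ℝ F] [FiniteDimensional ℝ F] {f : E → F} (hf : LocallyLipschitz f) :
    ∀ᵐ x ∂(stdGaussian E), DifferentiableAt ℝ f x :=
  (stdGaussian_absolutelyContinuous E).ae_le (hf.ae_differentiableAt volume)

end Density
-- Bounded functions of compact support, for integrability.
section CompactSupport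

variable {E : Type*} [NormedAddCommGroup E] [MeasurableSpace E]

/-- Bounded measurable functions with compact support. -/
structure BddCompactSupport (f : E → ℝ) : Prop where
  measurable : Measurable f
  hasCompactSupport : HasCompactSupport f
  bounded : ∃ C, ∀ x, ‖f x‖ ≤ C

variable {f g : E → ℝ}

theorem BddCompactSupport.integrable (hf : BddCompactSupport f)
    (μ : Measure E) [IsFiniteMeasureOnCompacts μ] : Integrable f μ := by
  obtain ⟨C, hC⟩ := hf.bounded
  have hK : IsCompact (tsupport f) := hf.hasCompactSupport
  rw [← integrableOn_iff_integrable_of_support_subset (subset_tsupport f)]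
  exact Measure.integrableOn_of_bounded hK.measure_lt_top.ne
    hf.measurable.aestronglyMeasurable (ae_of_all _ hC)

theorem BddCompactSupport.mul_continuous [BorelSpace E] (hf : BddCompactSupport f) (hg : Continuous g) :
    BddCompactSupport fun x => f x * g x := by
  obtain ⟨C, hC⟩ := hf.bounded
  obtain ⟨D, hD⟩ := (hf.hasCompactSupport : IsCompact (tsupport f)).exists_bound_of_continuousOn
    hg.continuousOn
  refine ⟨hf.measurable.mul hg.measurable, hf.hasCompactSupport.mul_right, C * |D|, fun x => ?_⟩
  have hC0 : 0 ≤ C := (norm_nonneg _).trans (hC x)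
  by_cases hx : x ∈ tsupport f
  · rw [norm_mul]
    exact mul_le_mul (hC x) ((hD x hx).trans (le_abs_self D)) (norm_nonneg _) hC0
  · rw [image_eq_zero_of_notMem_tsupport hx, zero_mul, norm_zero]
    positivity

theorem BddCompactSupport.mul (hf : BddCompactSupport f) (hg : BddCompactSupport g) :
    BddCompactSupport fun x => f x * g x := by
  obtain ⟨C, hC⟩ := hf.bounded
  obtain ⟨D, hD⟩ := hg.bounded
  refine ⟨hf.measurable.mul hg.measurable, hf.hasCompactSupport.mul_right, C * D, fun x => ?_⟩
  rw [norm_mul]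
  exact mul_le_mul (hC x) (hD x) (norm_nonneg _) ((norm_nonneg _).trans (hC x))

theorem BddCompactSupport.sub (hf : BddCompactSupport f) (hg : BddCompactSupport g) :
    BddCompactSupport fun x => f x - g x := by
  obtain ⟨C, hC⟩ := hf.bounded
  obtain ⟨D, hD⟩ := hg.bounded
  refine ⟨hf.measurable.sub hg.measurable, ?_, C + D, fun x => ?_⟩
  · exact hf.hasCompactSupport.comp₂_left (m := fun a b => a - b) hg.hasCompactSupport (by simp)
  · exact (norm_sub_le _ _).trans (add_le_add (hC x) (hD x))

end CompactSupport

/-! ### Integration by parts for Haar measure. -/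

section IntegrationByParts

variable {E : Type*} [NormedAddCommGroup E] [NormedSpace ℝ E] [FiniteDimensional ℝ E]
  [MeasurableSpace E] [BorelSpace E]

omit [NormedSpace ℝ E] [FiniteDimensional ℝ E] in
theorem LocallyLipschitz.bddCompactSupport {f : E → ℝ} (hf : LocallyLipschitz f)
    (hc : HasCompactSupport f) : BddCompactSupport f :=
  ⟨hf.continuous.measurable, hc, hc.exists_bound_of_continuous hf.continuous⟩

omit [FiniteDimensional ℝ E] [MeasurableSpace E] [BorelSpace E] in
theorem HasCompactSupport.lineDeriv {f : E → ℝ} (hc : HasCompactSupport f) (v : E) :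
    HasCompactSupport fun x => lineDeriv ℝ f x v := by
  refine HasCompactSupport.intro hc fun x hx => ?_
  rw [(notMem_tsupport_iff_eventuallyEq.1 hx).lineDeriv_eq]
  simp [_root_.lineDeriv]

theorem LocallyLipschitz.bddCompactSupport_lineDeriv {f : E → ℝ} (hf : LocallyLipschitz f)
    (hc : HasCompactSupport f) (v : E) : BddCompactSupport fun x => lineDeriv ℝ f x v := by
  obtain ⟨K, hK⟩ := hf.lipschitzWith_of_hasCompactSupport hc
  exact ⟨measurable_lineDeriv hf.continuous, hc.lineDeriv v, K * ‖v‖,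
    fun x => norm_lineDeriv_le_of_lipschitz ℝ hK⟩

omit [FiniteDimensional ℝ E] [MeasurableSpace E] [BorelSpace E] in
theorem lineDeriv_fun_mul {f g : E → ℝ} {x : E} (hf : DifferentiableAt ℝ f x)
    (hg : DifferentiableAt ℝ g x) (v : E) :
    lineDeriv ℝ (fun y => f y * g y) x v = lineDeriv ℝ f x v * g x + f x * lineDeriv ℝ g x v := by
  rw [(hf.fun_mul hg).lineDeriv_eq_fderiv, hf.lineDeriv_eq_fderiv, hg.lineDeriv_eq_fderiv,
    fderiv_fun_mul hf hg]
  simp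
  ring

omit [FiniteDimensional ℝ E] [MeasurableSpace E] [BorelSpace E] in
theorem lineDeriv_comp_add_right (f : E → ℝ) (a x v : E) :
    lineDeriv ℝ (fun y => f (y + a)) x v = lineDeriv ℝ f (x + a) v := by
  simp only [lineDeriv]
  congr 1
  ext t
  rw [add_right_comm]

variable (μ : Measure E) [μ.IsAddHaarMeasure]

theorem integral_lineDeriv_mul_eq_neg {f g : E → ℝ} (hf : LocallyLipschitz f)
    (hfc : HasCompactSupport f) (hg : LocallyLipschitz g) (hgc : HasCompactSupport g) (v : E) :
    ∫ x, lineDeriv ℝ f x v * g x ∂μ = -∫ x, f x * lineDeriv ℝ g x v ∂μ := by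
  obtain ⟨K, hK⟩ := hf.lipschitzWith_of_hasCompactSupport hfc
  obtain ⟨D, hD⟩ := hg.lipschitzWith_of_hasCompactSupport hgc
  rw [hK.integral_lineDeriv_mul_eq hD hgc v, ← integral_neg]
  congr 1 with x
  rw [lineDeriv_neg]
  ring

theorem integral_lineDeriv_eq_zero {f : E → ℝ} (hf : LocallyLipschitz f)
    (hfc : HasCompactSupport f) (v : E) : ∫ x, lineDeriv ℝ f x v ∂μ = 0 := by
  obtain ⟨K, hK⟩ := hf.lipschitzWith_of_hasCompactSupport hfc
  -- Integration by parts against the constant function 1.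
  have h := (LipschitzWith.const (1 : ℝ)).integral_lineDeriv_mul_eq hK hfc (-v) (μ := μ)
  have h1 : ∀ x : E, lineDeriv ℝ (fun _ : E => (1 : ℝ)) x (-v) = 0 := fun x => by simp [lineDeriv]
  simpa [h1] using h.symm

/-- Formally two integrations by parts, but second derivatives need not exist. The derivatives in
direction `w` are therefore replaced by difference quotients, and the limit `t → 0⁺` is taken at the
end. -/
theorem integral_lineDeriv_mul_lineDeriv_comm {f g : E → ℝ} (hf : LocallyLipschitz f)
    (hfc : HasCompactSupport f) (hg : LocallyLipschitz g) (hgc : HasCompactSupport g) (v w : E) :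
    ∫ x, lineDeriv ℝ f x v * lineDeriv ℝ g x w ∂μ =
      ∫ x, lineDeriv ℝ f x w * lineDeriv ℝ g x v ∂μ := by
  obtain ⟨K, hK⟩ := hf.lipschitzWith_of_hasCompactSupport hfc
  obtain ⟨D, hD⟩ := hg.lipschitzWith_of_hasCompactSupport hgc
  have hF := hf.bddCompactSupport_lineDeriv hfc v
  have hG := hg.bddCompactSupport_lineDeriv hgc v
  have A := hD.integral_inv_smul_sub_mul_tendsto_integral_lineDeriv_mul (hF.integrable μ) w
  have B := hK.integral_inv_smul_sub_mul_tendsto_integral_lineDeriv_mul (hG.integrable μ) (-w)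
  -- Translation commutes with the derivative along `v` and preserves `μ`, so the quotient of `g`
  -- along `w` becomes that of `f` along `-w`.
  have key : ∀ t : ℝ, ∫ x, (t⁻¹ • (g (x + t • w) - g x)) * lineDeriv ℝ f x v ∂μ =
      -∫ x, (t⁻¹ • (f (x + t • -w) - f x)) * lineDeriv ℝ g x v ∂μ := by
    intro t
    have hfs : LocallyLipschitz fun x => f (x + t • -w) :=
      hf.comp (LipschitzWith.id.add (LipschitzWith.const _)).locallyLipschitz
    have hfsc : HasCompactSupport fun x => f (x + t • -w) :=
      hfc.comp_homeomorph (Homeomorph.addRight (t • -w))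
    have hgs : Continuous fun x => g (x + t • w) := hg.continuous.comp (continuous_add_const _)
    have h1 : ∫ x, lineDeriv ℝ f x v * g (x + t • w) ∂μ =
        -∫ x, f (x + t • -w) * lineDeriv ℝ g x v ∂μ := by
      rw [← integral_lineDeriv_mul_eq_neg μ hfs hfsc hg hgc v,
        ← integral_add_right_eq_self _ (t • -w)]
      simp [lineDeriv_comp_add_right]
    have h2 := integral_lineDeriv_mul_eq_neg μ hf hfc hg hgc v
    have e1 : ∀ x, (t⁻¹ • (g (x + t • w) - g x)) * lineDeriv ℝ f x v =
        t⁻¹ * (lineDeriv ℝ f x v * g (x + t • w) - lineDeriv ℝ f x v * g x) := by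
      intro x; rw [smul_eq_mul]; ring
    have e2 : ∀ x, (t⁻¹ • (f (x + t • -w) - f x)) * lineDeriv ℝ g x v =
        t⁻¹ * (f (x + t • -w) * lineDeriv ℝ g x v - f x * lineDeriv ℝ g x v) := by
      intro x; rw [smul_eq_mul]; ring
    simp_rw [e1, e2]
    rw [integral_const_mul, integral_const_mul,
      integral_sub ((hF.mul_continuous hgs).integrable μ)
        ((hF.mul_continuous hg.continuous).integrable μ),
      integral_sub (((hfs.bddCompactSupport hfsc).mul hG).integrable μ)
        (((hf.bddCompactSupport hfc).mul hG).integrable μ), h1, h2]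
    ring
  simp_rw [key] at A
  have := tendsto_nhds_unique A B.neg
  simp only [lineDeriv_neg, neg_mul, integral_neg, neg_neg] at this
  rw [← this]
  congr 1 with x
  ring

end IntegrationByParts

/-! ### Stein's formulas for compactly supported functions. -/

section GaussianCompactSupport

variable {E : Type*} [NormedAddCommGroup E] [InnerProductSpace ℝ E] [FiniteDimensional ℝ E]
  [MeasurableSpace E] [BorelSpace E]

omit [FiniteDimensional ℝ E] [MeasurableSpace E] [BorelSpace E] in
theorem locallyLipschitz_inner_left (v : E) : LocallyLipschitz fun x : E => ⟪v, x⟫ :=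
  (innerSL ℝ v).lipschitz.locallyLipschitz

/-- The derivative of `f` times the density integrates to zero, and differentiating the density
produces `-⟪v, x⟫`. -/
theorem integral_lineDeriv_stdGaussian {f : E → ℝ} (hf : LocallyLipschitz f)
    (hfc : HasCompactSupport f) (v : E) :
    ∫ x, lineDeriv ℝ f x v ∂(stdGaussian E) = ∫ x, ⟪v, x⟫ * f x ∂(stdGaussian E) := by
  have hφ := (contDiff_gaussianDensity E).locallyLipschitz
  have h := integral_lineDeriv_eq_zero volume (hφ.real_mul hf) (hfc.mul_left) v
  have hae : ∀ᵐ x : E, lineDeriv ℝ (fun y => gaussianDensity E y * f y) x v =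
      lineDeriv ℝ f x v * gaussianDensity E x - (f x * ⟪v, x⟫) * gaussianDensity E x := by
    filter_upwards [hf.ae_differentiableAt volume] with x hx
    rw [lineDeriv_fun_mul ((contDiff_gaussianDensity E).differentiable one_ne_zero x) hx,
      lineDeriv_gaussianDensity]
    ring
  have hin : Continuous fun x : E => ⟪v, x⟫ := by fun_prop
  rw [integral_congr_ae hae, integral_sub
    (((hf.bddCompactSupport_lineDeriv hfc v).mul_continuous hφ.continuous).integrable _)
    ((((hf.bddCompactSupport hfc).mul_continuous hin).mul_continuous hφ.continuous).integrable _),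
    sub_eq_zero] at h
  rw [integral_stdGaussian_eq_integral_density, integral_stdGaussian_eq_integral_density]
  refine (integral_congr_ae (ae_of_all _ fun x => ?_)).trans
    (h.trans (integral_congr_ae (ae_of_all _ fun x => ?_)))
  · exact mul_comm _ _
  · ring

/-- The adjoint, for the standard Gaussian measure, of the derivative in direction `v`. -/
noncomputable def gaussianDiv (f : E → ℝ) (v x : E) : ℝ :=
  ⟪v, x⟫ * f x - lineDeriv ℝ f x v

theorem LocallyLipschitz.bddCompactSupport_gaussianDiv {f : E → ℝ} (hf : LocallyLipschitz f)
    (hfc : HasCompactSupport f) (v : E) : BddCompactSupport (gaussianDiv f v) := by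
  have hin : Continuous fun x : E => ⟪v, x⟫ := by fun_prop
  have := ((hf.bddCompactSupport hfc).mul_continuous hin).sub
    (hf.bddCompactSupport_lineDeriv hfc v)
  unfold gaussianDiv
  simpa only [mul_comm] using this

/-- Second order Stein formula. -/
theorem integral_gaussianDiv_mul_gaussianDiv {f g : E → ℝ} (hf : LocallyLipschitz f)
    (hfc : HasCompactSupport f) (hg : LocallyLipschitz g) (hgc : HasCompactSupport g) (v w : E) :
    ∫ x, gaussianDiv f v x * gaussianDiv g w x ∂(stdGaussian E) =
      (∫ x, lineDeriv ℝ f x w * lineDeriv ℝ g x v ∂(stdGaussian E)) +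
        ⟪w, v⟫ * ∫ x, f x * g x ∂(stdGaussian E) := by
  have hφ := (contDiff_gaussianDensity E).locallyLipschitz
  have hin : Continuous fun x : E => ⟪w, x⟫ := by fun_prop
  -- With this `U`, the density times `gaussianDiv f v` is minus the derivative of `U` along `v`:
  -- the problem becomes one about Lebesgue measure.
  set U : E → ℝ := fun x => gaussianDensity E x * f x with hU
  have hUl : LocallyLipschitz U := hφ.real_mul hf
  have hUc : HasCompactSupport U := hfc.mul_left
  have hUb := hUl.bddCompactSupport hUc
  have hdU : ∀ᵐ x : E, ∀ v, lineDeriv ℝ U x v =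
      gaussianDensity E x * lineDeriv ℝ f x v - ⟪v, x⟫ * U x := by
    filter_upwards [hf.ae_differentiableAt volume] with x hx v
    rw [lineDeriv_fun_mul ((contDiff_gaussianDensity E).differentiable one_ne_zero x) hx,
      lineDeriv_gaussianDensity]
    ring
  have hdg : ∀ᵐ x : E, lineDeriv ℝ (fun x => ⟪w, x⟫ * g x) x v =
      ⟪w, v⟫ * g x + ⟪w, x⟫ * lineDeriv ℝ g x v := by
    filter_upwards [hg.ae_differentiableAt volume] with x hx
    have h1 : HasFDerivAt (fun x : E => ⟪w, x⟫) (innerSL ℝ w) x := (innerSL ℝ w).hasFDerivAt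
    rw [lineDeriv_fun_mul h1.differentiableAt hx, (h1.hasLineDerivAt v).lineDeriv]
    rfl
  have hUv := hUl.bddCompactSupport_lineDeriv hUc v
  have hUw := hUl.bddCompactSupport_lineDeriv hUc w
  have hgv := hg.bddCompactSupport_lineDeriv hgc v
  have hgw := hg.bddCompactSupport_lineDeriv hgc w
  have hwg : LocallyLipschitz fun x => ⟪w, x⟫ * g x := (locallyLipschitz_inner_left w).real_mul hg
  simp_rw [integral_stdGaussian_eq_integral_density]
  calc ∫ x, gaussianDensity E x * (gaussianDiv f v x * gaussianDiv g w x)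
      = ∫ x, (lineDeriv ℝ U x v * lineDeriv ℝ g x w - lineDeriv ℝ U x v * (⟪w, x⟫ * g x)) := by
        refine integral_congr_ae ?_
        filter_upwards [hdU] with x hx
        rw [hx, gaussianDiv, gaussianDiv]
        simp only [hU]
        ring
    _ = (∫ x, lineDeriv ℝ U x w * lineDeriv ℝ g x v) +
          ∫ x, U x * lineDeriv ℝ (fun x => ⟪w, x⟫ * g x) x v := by
        rw [integral_sub ((hUv.mul hgw).integrable _)
          ((hUv.mul_continuous hwg.continuous).integrable _),
          integral_lineDeriv_mul_lineDeriv_comm volume hUl hUc hg hgc,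
          integral_lineDeriv_mul_eq_neg volume hUl hUc hwg hgc.mul_left, sub_neg_eq_add]
    -- The two terms `⟪w, x⟫ * U x * lineDeriv ℝ g x v`, one from each integrand, cancel.
    _ = ∫ x, (gaussianDensity E x * (lineDeriv ℝ f x w * lineDeriv ℝ g x v) +
          ⟪w, v⟫ * (gaussianDensity E x * (f x * g x))) := by
        rw [← integral_add ((hUw.mul hgv).integrable _)
          ((hUb.mul (hwg.bddCompactSupport_lineDeriv hgc.mul_left v)).integrable _)]
        refine integral_congr_ae ?_
        filter_upwards [hdU, hdg] with x hx hx'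
        rw [hx, hx']
        simp only [hU]
        ring
    _ = _ := by
        have i1 := (((hf.bddCompactSupport_lineDeriv hfc w).mul hgv).mul_continuous
          hφ.continuous).integrable (volume : Measure E)
        have i2 := (((hf.bddCompactSupport hfc).mul (hg.bddCompactSupport hgc)).mul_continuous
          hφ.continuous).integrable (volume : Measure E)
        rw [integral_add, integral_const_mul]
        · exact i1.congr (ae_of_all _ fun x => mul_comm _ _)
        · exact (i2.congr (ae_of_all _ fun x => mul_comm _ _)).const_mul _

end GaussianCompactSupport
-- Second moment estimates: Fatou's lemma and cutoffs.
section GaussianEnergy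

variable {E : Type*} [NormedAddCommGroup E]

theorem lintegral_enorm_sq_eq_ofReal {α : Type*} [MeasurableSpace α] {μ : Measure α} {f : α → ℝ}
    (hf : Integrable (fun x => f x ^ 2) μ) :
    ∫⁻ x, ‖f x‖ₑ ^ 2 ∂μ = ENNReal.ofReal (∫ x, f x ^ 2 ∂μ) := by
  rw [ofReal_integral_eq_lintegral_ofReal hf (ae_of_all _ fun x => sq_nonneg _)]
  congr 1 with x
  rw [Real.enorm_eq_ofReal_abs, ← ENNReal.ofReal_pow (abs_nonneg _), sq_abs]

/-- Fatou's lemma, in the form that transfers a uniform bound from cut-off functions to the original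
one. -/
theorem lintegral_le_of_eventually_eq {α : Type*} [MeasurableSpace α] {μ : Measure α}
    {F : ℕ → α → ℝ≥0∞} {G : α → ℝ≥0∞} {B : ℝ≥0∞} (hF : ∀ n, Measurable (F n))
    (hG : ∀ x, ∀ᶠ n in atTop, F n x = G x) (hB : ∀ n, ∫⁻ x, F n x ∂μ ≤ B) :
    ∫⁻ x, G x ∂μ ≤ B := by
  have h : ∀ x, liminf (fun n => F n x) atTop = G x := fun x =>
    (tendsto_const_nhds.congr' ((hG x).mono fun n hn => hn.symm)).liminf_eq
  calc ∫⁻ x, G x ∂μ = ∫⁻ x, liminf (fun n => F n x) atTop ∂μ := by simp_rw [h]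
    _ ≤ liminf (fun n => ∫⁻ x, F n x ∂μ) atTop := lintegral_liminf_le hF
    _ ≤ B := by
      refine (liminf_le_liminf (Eventually.of_forall hB)).trans ?_
      simp

theorem enorm_add_sq_le {F : Type*} [SeminormedAddCommGroup F] (a b : F) :
    ‖a + b‖ₑ ^ 2 ≤ 2 * ‖a‖ₑ ^ 2 + 2 * ‖b‖ₑ ^ 2 := by
  have h : ‖a + b‖ ^ 2 ≤ 2 * ‖a‖ ^ 2 + 2 * ‖b‖ ^ 2 := by
    have := norm_add_le a b
    nlinarith [norm_nonneg (a + b), norm_nonneg a, norm_nonneg b, sq_nonneg (‖a‖ - ‖b‖)]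
  have := ENNReal.ofReal_le_ofReal h
  rw [ENNReal.ofReal_add (by positivity) (by positivity), ENNReal.ofReal_mul (by norm_num),
    ENNReal.ofReal_mul (by norm_num)] at this
  simpa [ENNReal.ofReal_pow, ofReal_norm] using this

section Cutoff

/-- The function equal to `1` on the ball of radius `n` and to `0` off the ball of radius `n + 1`,
affine in the norm in between. -/
noncomputable def normCutoff (n : ℕ) (x : E) : ℝ := max 0 (min 1 (n + 1 - ‖x‖))

theorem lipschitzWith_normCutoff (n : ℕ) : LipschitzWith 1 (normCutoff n : E → ℝ) := by
  have h : LipschitzWith 1 fun x : E => (n + 1 : ℝ) - ‖x‖ := by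
    refine LipschitzWith.of_dist_le_mul fun x y => ?_
    rw [Real.dist_eq, NNReal.coe_one, one_mul, dist_eq_norm]
    have : (n + 1 : ℝ) - ‖x‖ - (n + 1 - ‖y‖) = ‖y‖ - ‖x‖ := by ring
    rw [this, abs_sub_comm]
    exact abs_norm_sub_norm_le x y
  exact (h.const_min 1).const_max 0

theorem normCutoff_nonneg (n : ℕ) (x : E) : 0 ≤ normCutoff n x := le_max_left _ _

theorem normCutoff_le_one (n : ℕ) (x : E) : normCutoff n x ≤ 1 :=
  max_le zero_le_one (min_le_left _ _)

theorem normCutoff_eq_one {n : ℕ} {x : E} (hx : ‖x‖ ≤ n) : normCutoff n x = 1 := by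
  rw [normCutoff, min_eq_left (by linarith), max_eq_right zero_le_one]

theorem hasCompactSupport_normCutoff [NormedSpace ℝ E] [FiniteDimensional ℝ E] (n : ℕ) :
    HasCompactSupport (normCutoff n : E → ℝ) := by
  refine HasCompactSupport.intro (isCompact_closedBall (0 : E) (n + 1)) fun x hx => ?_
  rw [mem_closedBall_zero_iff, not_le] at hx
  rw [normCutoff, max_eq_left]
  exact (min_le_right _ _).trans (by linarith)

/-- Multiply by `normCutoff n`. It is 1-Lipschitz and at most 1, so the product rule gives a
gradient bound uniform in `n`. Agreement near each point, not merely at it, makes the derivatives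
agree eventually. -/
theorem LocallyLipschitz.exists_compactSupport_approx [NormedSpace ℝ E] [FiniteDimensional ℝ E]
    [MeasurableSpace E] [BorelSpace E] (μ : Measure E) [μ.IsAddHaarMeasure] {f : E → ℝ}
    (hf : LocallyLipschitz f) : ∃ F : ℕ → E → ℝ, (∀ n, LocallyLipschitz (F n)) ∧
      (∀ n, HasCompactSupport (F n)) ∧ (∀ n x, ‖F n x‖ₑ ≤ ‖f x‖ₑ) ∧
      (∀ x, ∀ᶠ n in atTop, F n =ᶠ[𝓝 x] f) ∧
      ∀ n, ∀ᵐ x ∂μ, ‖fderiv ℝ (F n) x‖ₑ ^ 2 ≤ 2 * ‖fderiv ℝ f x‖ₑ ^ 2 + 2 * ‖f x‖ₑ ^ 2 := by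
  have hχ (n : ℕ) := (lipschitzWith_normCutoff (E := E) n).locallyLipschitz
  have hle (n : ℕ) (x : E) : ‖normCutoff n x‖ₑ ≤ 1 := by
    rw [Real.enorm_eq_ofReal (normCutoff_nonneg n x)]
    exact ENNReal.ofReal_le_one.2 (normCutoff_le_one n x)
  refine ⟨fun n x => normCutoff n x * f x, fun n => (hχ n).real_mul hf,
    fun n => (hasCompactSupport_normCutoff n).mul_right, fun n x => ?_, fun x => ?_, fun n => ?_⟩
  · rw [enorm_mul]
    exact mul_le_of_le_one_left' (hle n x)
  · obtain ⟨N, hN⟩ := exists_nat_gt ‖x‖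
    filter_upwards [eventually_ge_atTop N] with n hn
    have hx : x ∈ ball (0 : E) n := by
      rw [mem_ball_zero_iff]
      exact hN.trans_le (by exact_mod_cast hn)
    filter_upwards [isOpen_ball.mem_nhds hx] with y hy
    rw [mem_ball_zero_iff] at hy
    rw [normCutoff_eq_one hy.le, one_mul]
  · filter_upwards [hf.ae_differentiableAt μ, (hχ n).ae_differentiableAt μ] with x hx hx'
    rw [fderiv_fun_mul hx' hx]
    refine (enorm_add_sq_le _ _).trans ?_
    rw [enorm_smul, enorm_smul]
    have h1 : ‖fderiv ℝ (normCutoff n) x‖ₑ ≤ 1 := by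
      have := norm_fderiv_le_of_lipschitz ℝ (lipschitzWith_normCutoff (E := E) n) (x₀ := x)
      rw [← ofReal_norm]
      exact ENNReal.ofReal_le_one.2 (by simpa using this)
    gcongr
    · exact mul_le_of_le_one_left' (hle n x)
    · exact mul_le_of_le_one_right' h1

end Cutoff

/-! ### Energy bounds for Gaussian divergences and for linear weights. -/

variable [InnerProductSpace ℝ E] [FiniteDimensional ℝ E] [MeasurableSpace E] [BorelSpace E]
  {ι : Type*} [Fintype ι] (b : OrthonormalBasis ι ℝ E)

theorem lintegral_fderiv_eq_ofReal_sum {f : E → ℝ} (hf : LocallyLipschitz f)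
    (hfc : HasCompactSupport f) :
    ∫⁻ x, ‖fderiv ℝ f x‖ₑ ^ 2 ∂(stdGaussian E) =
      ENNReal.ofReal (∑ i, ∫ x, lineDeriv ℝ f x (b i) ^ 2 ∂(stdGaussian E)) := by
  have hi : ∀ i, Integrable (fun x => lineDeriv ℝ f x (b i) ^ 2) (stdGaussian E) := fun i => by
    have h := hf.bddCompactSupport_lineDeriv hfc (b i)
    simpa only [sq] using (h.mul h).integrable (stdGaussian E)
  rw [← integral_finsetSum _ fun i _ => hi i, ofReal_integral_eq_lintegral_ofReal
    (integrable_finsetSum _ fun i _ => hi i)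
    (ae_of_all _ fun x => Finset.sum_nonneg fun i _ => sq_nonneg _)]
  refine lintegral_congr_ae ?_
  filter_upwards [hf.ae_differentiableAt_stdGaussian] with x hx
  rw [← ofReal_norm, ← ENNReal.ofReal_pow (norm_nonneg _), b.norm_dual]
  simp [hx.lineDeriv_eq_fderiv]

/-- Expanding the square by the second order Stein formula leaves `∑ E (u i)²` plus the mean of the
trace of the squared Jacobian; by `2ab ≤ a² + b²` that trace is at most the squared Frobenius norm.
-/
theorem lintegral_sum_gaussianDiv_le_of_hasCompactSupport {u : ι → E → ℝ}
    (hu : ∀ i, LocallyLipschitz (u i)) (hc : ∀ i, HasCompactSupport (u i)) :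
    ∫⁻ x, ‖∑ i, gaussianDiv (u i) (b i) x‖ₑ ^ 2 ∂(stdGaussian E) ≤
      ∑ i, (∫⁻ x, ‖u i x‖ₑ ^ 2 ∂(stdGaussian E) +
        ∫⁻ x, ‖fderiv ℝ (u i) x‖ₑ ^ 2 ∂(stdGaussian E)) := by
  classical
  have hb := fun i => (hu i).bddCompactSupport (hc i)
  have hd := fun i v => (hu i).bddCompactSupport_lineDeriv (hc i) v
  have hg := fun i => (hu i).bddCompactSupport_gaussianDiv (hc i) (b i)
  have hbi : ∀ i, Integrable (fun x => u i x ^ 2) (stdGaussian E) := fun i => by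
    simpa only [sq] using ((hb i).mul (hb i)).integrable (stdGaussian E)
  have hdi : ∀ i v, Integrable (fun x => lineDeriv ℝ (u i) x v ^ 2) (stdGaussian E) :=
    fun i v => by simpa only [sq] using ((hd i v).mul (hd i v)).integrable (stdGaussian E)
  have hgi : ∀ i j, Integrable (fun x => gaussianDiv (u i) (b i) x * gaussianDiv (u j) (b j) x)
      (stdGaussian E) := fun i j => ((hg i).mul (hg j)).integrable _
  have hexp : ∀ x, (∑ i, gaussianDiv (u i) (b i) x) ^ 2 =
      ∑ i, ∑ j, gaussianDiv (u i) (b i) x * gaussianDiv (u j) (b j) x := fun x => by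
    rw [sq, Finset.sum_mul_sum]
  rw [lintegral_enorm_sq_eq_ofReal]
  swap
  · simp_rw [hexp]
    exact integrable_finsetSum _ fun i _ => integrable_finsetSum _ fun j _ => hgi i j
  simp_rw [lintegral_enorm_sq_eq_ofReal (hbi _), lintegral_fderiv_eq_ofReal_sum b (hu _) (hc _)]
  have hpos1 : ∀ i, 0 ≤ ∫ x, u i x ^ 2 ∂(stdGaussian E) := fun i =>
    integral_nonneg fun x => sq_nonneg _
  have hpos2 : ∀ i, 0 ≤ ∑ j, ∫ x, lineDeriv ℝ (u i) x (b j) ^ 2 ∂(stdGaussian E) := fun i =>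
    Finset.sum_nonneg fun j _ => integral_nonneg fun x => sq_nonneg _
  simp_rw [← ENNReal.ofReal_add (hpos1 _) (hpos2 _)]
  rw [← ENNReal.ofReal_sum_of_nonneg fun i _ => add_nonneg (hpos1 i) (hpos2 i)]
  refine ENNReal.ofReal_le_ofReal ?_
  simp_rw [hexp]
  rw [integral_finsetSum _ fun i _ => integrable_finsetSum _ fun j _ => hgi i j]
  simp_rw [integral_finsetSum _ fun j _ => hgi _ j,
    integral_gaussianDiv_mul_gaussianDiv (hu _) (hc _) (hu _) (hc _),
    b.inner_eq_ite, ite_mul, one_mul, zero_mul]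
  have hcross : ∀ i j, ∫ x, lineDeriv ℝ (u i) x (b j) * lineDeriv ℝ (u j) x (b i) ∂(stdGaussian E) ≤
      (1 / 2) * ∫ x, lineDeriv ℝ (u i) x (b j) ^ 2 ∂(stdGaussian E) +
      (1 / 2) * ∫ x, lineDeriv ℝ (u j) x (b i) ^ 2 ∂(stdGaussian E) := by
    intro i j
    rw [← integral_const_mul, ← integral_const_mul,
      ← integral_add ((hdi _ _).const_mul _) ((hdi _ _).const_mul _)]
    refine integral_mono (((hd i _).mul (hd j _)).integrable _)
      (((hdi _ _).const_mul _).add ((hdi _ _).const_mul _)) fun x => ?_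
    simp only []
    nlinarith [sq_nonneg (lineDeriv ℝ (u i) x (b j) - lineDeriv ℝ (u j) x (b i))]
  calc _ ≤ ∑ i, ∑ j, (((1 / 2) * ∫ x, lineDeriv ℝ (u i) x (b j) ^ 2 ∂(stdGaussian E) +
      (1 / 2) * ∫ x, lineDeriv ℝ (u j) x (b i) ^ 2 ∂(stdGaussian E)) +
      if j = i then ∫ x, u i x * u j x ∂(stdGaussian E) else 0) :=
        Finset.sum_le_sum fun i _ => Finset.sum_le_sum fun j _ =>
          add_le_add_left (hcross i j) _
    _ = _ := by
      simp_rw [Finset.sum_add_distrib, Finset.sum_ite_eq' Finset.univ, Finset.mem_univ, if_true]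
      rw [Finset.sum_comm (f := fun i j =>
        (1 / 2) * ∫ x, lineDeriv ℝ (u j) x (b i) ^ 2 ∂(stdGaussian E))]
      simp_rw [← Finset.mul_sum, sq]
      ring

theorem lintegral_sum_gaussianDiv_le {u : ι → E → ℝ} (hu : ∀ i, LocallyLipschitz (u i)) :
    ∫⁻ x, ‖∑ i, gaussianDiv (u i) (b i) x‖ₑ ^ 2 ∂(stdGaussian E) ≤
      ∑ i, (3 * ∫⁻ x, ‖u i x‖ₑ ^ 2 ∂(stdGaussian E) +
        2 * ∫⁻ x, ‖fderiv ℝ (u i) x‖ₑ ^ 2 ∂(stdGaussian E)) := by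
  choose F hF hFc hFle hFeq hFd using fun i => (hu i).exists_compactSupport_approx volume
  refine lintegral_le_of_eventually_eq
    (F := fun n x => ‖∑ i, gaussianDiv (F i n) (b i) x‖ₑ ^ 2) (fun n => ?_) (fun x => ?_)
    fun n => (lintegral_sum_gaussianDiv_le_of_hasCompactSupport b (fun i => hF i n)
      fun i => hFc i n).trans (Finset.sum_le_sum fun i _ => ?_)
  · have := fun i => ((hF i n).bddCompactSupport_gaussianDiv (hFc i n) (b i)).measurable
    fun_prop
  · filter_upwards [eventually_all.2 fun i => hFeq i x] with n hn
    simp_rw [gaussianDiv, (hn _).lineDeriv_eq, (hn _).eq_of_nhds]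
  · have h1 : ∫⁻ x, ‖F i n x‖ₑ ^ 2 ∂(stdGaussian E) ≤ ∫⁻ x, ‖u i x‖ₑ ^ 2 ∂(stdGaussian E) :=
      lintegral_mono fun x => by gcongr; exact hFle i n x
    have h2 : ∫⁻ x, ‖fderiv ℝ (F i n) x‖ₑ ^ 2 ∂(stdGaussian E) ≤
        2 * ∫⁻ x, ‖fderiv ℝ (u i) x‖ₑ ^ 2 ∂(stdGaussian E) +
          2 * ∫⁻ x, ‖u i x‖ₑ ^ 2 ∂(stdGaussian E) := by
      have hm := measurable_fderiv ℝ (u i)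
      rw [← lintegral_const_mul _ (by fun_prop), ← lintegral_const_mul _
        (by have := (hu i).continuous; fun_prop), ← lintegral_add_left (by fun_prop)]
      exact lintegral_mono_ae ((stdGaussian_absolutelyContinuous E).ae_le (hFd i n))
    -- The cutoff turns the constants 1, 1 into 1 + 2 and 2.
    refine (add_le_add h1 h2).trans (le_of_eq ?_)
    ring

/-- Stein's identity for `f² ⟪q, x⟫` expresses the left side as `E f² + 2 E (f ∂_q f ⟪q, x⟫)`. By
Young's inequality the cross term is at most half the left side, which is finite and can be
absorbed, plus `2 E (∂_q f)²`. -/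
theorem lintegral_enorm_sq_mul_inner_le_of_hasCompactSupport {f : E → ℝ} (hf : LocallyLipschitz f)
    (hfc : HasCompactSupport f) {q : E} (hq : ‖q‖ = 1) :
    ∫⁻ x, ‖f x‖ₑ ^ 2 * ‖⟪q, x⟫‖ₑ ^ 2 ∂(stdGaussian E) ≤
      2 * ∫⁻ x, ‖f x‖ₑ ^ 2 ∂(stdGaussian E) +
        4 * ∫⁻ x, ‖fderiv ℝ f x‖ₑ ^ 2 ∂(stdGaussian E) := by
  have hin := locallyLipschitz_inner_left q
  have hff := hf.real_mul hf
  have hb := hf.bddCompactSupport hfc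
  have hd := hf.bddCompactSupport_lineDeriv hfc q
  have hbi : Integrable (fun x => f x ^ 2) (stdGaussian E) := by
    simpa only [sq] using (hb.mul hb).integrable (stdGaussian E)
  have hdi : Integrable (fun x => lineDeriv ℝ f x q ^ 2) (stdGaussian E) := by
    simpa only [sq] using (hd.mul hd).integrable (stdGaussian E)
  have hci : Integrable (fun x => (f x * lineDeriv ℝ f x q) * ⟪q, x⟫) (stdGaussian E) :=
    ((hb.mul hd).mul_continuous hin.continuous).integrable _
  have hsi : Integrable (fun x => (f x * ⟪q, x⟫) ^ 2) (stdGaussian E) := by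
    have := hb.mul_continuous hin.continuous
    simpa only [sq] using (this.mul this).integrable (stdGaussian E)
  have h := integral_lineDeriv_stdGaussian (hff.real_mul hin) hfc.mul_left.mul_right q
  have hae : ∀ᵐ x ∂(stdGaussian E), lineDeriv ℝ (fun x => f x * f x * ⟪q, x⟫) x q =
      f x ^ 2 + 2 * ((f x * lineDeriv ℝ f x q) * ⟪q, x⟫) := by
    filter_upwards [hf.ae_differentiableAt_stdGaussian] with x hx
    have h1 : HasFDerivAt (fun x : E => ⟪q, x⟫) (innerSL ℝ q) x := (innerSL ℝ q).hasFDerivAt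
    rw [lineDeriv_fun_mul (hx.fun_mul hx) h1.differentiableAt, lineDeriv_fun_mul hx hx,
      (h1.hasLineDerivAt q).lineDeriv, innerSL_apply_apply, real_inner_self_eq_norm_sq, hq]
    ring
  have hS : ∫ x, ⟪q, x⟫ * (f x * f x * ⟪q, x⟫) ∂(stdGaussian E) =
      ∫ x, (f x * ⟪q, x⟫) ^ 2 ∂(stdGaussian E) := by
    congr 1 with x
    ring
  rw [integral_congr_ae hae, hS, integral_add hbi (hci.const_mul _), integral_const_mul] at h
  have hY : 2 * ∫ x, (f x * lineDeriv ℝ f x q) * ⟪q, x⟫ ∂(stdGaussian E) ≤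
      (1 / 2) * ∫ x, (f x * ⟪q, x⟫) ^ 2 ∂(stdGaussian E) +
        2 * ∫ x, lineDeriv ℝ f x q ^ 2 ∂(stdGaussian E) := by
    rw [← integral_const_mul, ← integral_const_mul, ← integral_const_mul,
      ← integral_add (hsi.const_mul _) (hdi.const_mul _)]
    refine integral_mono (hci.const_mul _) ((hsi.const_mul _).add (hdi.const_mul _)) fun x => ?_
    simp only []
    nlinarith [sq_nonneg (f x * ⟪q, x⟫ - 2 * lineDeriv ℝ f x q)]
  have hfin : ∫ x, (f x * ⟪q, x⟫) ^ 2 ∂(stdGaussian E) ≤ 2 * ∫ x, f x ^ 2 ∂(stdGaussian E) +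
      4 * ∫ x, lineDeriv ℝ f x q ^ 2 ∂(stdGaussian E) := by linarith
  have hgrad : ∫⁻ x, ‖lineDeriv ℝ f x q‖ₑ ^ 2 ∂(stdGaussian E) ≤
      ∫⁻ x, ‖fderiv ℝ f x‖ₑ ^ 2 ∂(stdGaussian E) := by
    refine lintegral_mono_ae ?_
    filter_upwards [hf.ae_differentiableAt_stdGaussian] with x hx
    rw [hx.lineDeriv_eq_fderiv]
    gcongr
    have := (fderiv ℝ f x).le_opENorm q
    rwa [← ofReal_norm q, hq, ENNReal.ofReal_one, mul_one] at this
  simp_rw [← mul_pow, ← enorm_mul]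
  rw [lintegral_enorm_sq_eq_ofReal hsi]
  refine (ENNReal.ofReal_le_ofReal hfin).trans ?_
  rw [ENNReal.ofReal_add (by positivity) (by positivity), ENNReal.ofReal_mul (by norm_num),
    ENNReal.ofReal_mul (by norm_num), ← lintegral_enorm_sq_eq_ofReal hbi,
    ← lintegral_enorm_sq_eq_ofReal hdi]
  norm_num
  gcongr

theorem lintegral_enorm_sq_mul_inner_le {f : E → ℝ} (hf : LocallyLipschitz f) {q : E}
    (hq : ‖q‖ = 1) :
    ∫⁻ x, ‖f x‖ₑ ^ 2 * ‖⟪q, x⟫‖ₑ ^ 2 ∂(stdGaussian E) ≤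
      10 * ∫⁻ x, ‖f x‖ₑ ^ 2 ∂(stdGaussian E) +
        8 * ∫⁻ x, ‖fderiv ℝ f x‖ₑ ^ 2 ∂(stdGaussian E) := by
  obtain ⟨F, hF, hFc, hFle, hFeq, hFd⟩ := hf.exists_compactSupport_approx volume
  refine lintegral_le_of_eventually_eq
    (F := fun n x => ‖F n x‖ₑ ^ 2 * ‖⟪q, x⟫‖ₑ ^ 2) (fun n => ?_) (fun x => ?_)
    fun n => (lintegral_enorm_sq_mul_inner_le_of_hasCompactSupport (hF n) (hFc n) hq).trans ?_
  · have := (hF n).continuous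
    fun_prop
  · filter_upwards [hFeq x] with n hn
    rw [hn.eq_of_nhds]
  · have h1 : ∫⁻ x, ‖F n x‖ₑ ^ 2 ∂(stdGaussian E) ≤ ∫⁻ x, ‖f x‖ₑ ^ 2 ∂(stdGaussian E) :=
      lintegral_mono fun x => by gcongr; exact hFle n x
    have h2 : ∫⁻ x, ‖fderiv ℝ (F n) x‖ₑ ^ 2 ∂(stdGaussian E) ≤
        2 * ∫⁻ x, ‖fderiv ℝ f x‖ₑ ^ 2 ∂(stdGaussian E) +
          2 * ∫⁻ x, ‖f x‖ₑ ^ 2 ∂(stdGaussian E) := by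
      have hm := measurable_fderiv ℝ f
      rw [← lintegral_const_mul _ (by fun_prop), ← lintegral_const_mul _
        (by have := hf.continuous; fun_prop), ← lintegral_add_left (by fun_prop)]
      exact lintegral_mono_ae ((stdGaussian_absolutelyContinuous E).ae_le (hFd n))
    -- The constants are 10 = 2 + 4 · 2 and 8 = 4 · 2.
    refine (add_le_add (mul_le_mul_right h1 2) (mul_le_mul_right h2 4)).trans (le_of_eq ?_)
    ring

end GaussianEnergy
-- Gaussian Poincaré inequality by rotation of an independent pair.
section Poincare

variable {E : Type*} [NormedAddCommGroup E] [InnerProductSpace ℝ E]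

/-- The rotation `(x, y) ↦ (cos θ x + sin θ y, -sin θ x + cos θ y)` of `E × E`. -/
noncomputable def pairRotation (E : Type*) [NormedAddCommGroup E] [InnerProductSpace ℝ E] (θ : ℝ) :
    E × E →L[ℝ] E × E :=
  (Real.cos θ • ContinuousLinearMap.fst ℝ E E + Real.sin θ • ContinuousLinearMap.snd ℝ E E).prod
    (-Real.sin θ • ContinuousLinearMap.fst ℝ E E + Real.cos θ • ContinuousLinearMap.snd ℝ E E)

theorem pairRotation_apply (θ : ℝ) (p : E × E) : pairRotation E θ p =
    (Real.cos θ • p.1 + Real.sin θ • p.2, -Real.sin θ • p.1 + Real.cos θ • p.2) := rfl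

theorem sq_lintegral_le_mul {α : Type*} [MeasurableSpace α] {μ : Measure α} {f : α → ℝ≥0∞}
    (hf : AEMeasurable f μ) : (∫⁻ x, f x ∂μ) ^ 2 ≤ μ univ * ∫⁻ x, f x ^ 2 ∂μ := by
  have h := ENNReal.lintegral_mul_le_Lp_mul_Lq μ Real.HolderConjugate.two_two
    (aemeasurable_const (b := (1 : ℝ≥0∞))) hf
  simp only [Pi.mul_apply, one_mul, ENNReal.one_rpow, lintegral_one] at h
  calc (∫⁻ x, f x ∂μ) ^ 2 ≤ (μ univ ^ (1 / 2 : ℝ) * (∫⁻ x, f x ^ (2 : ℝ) ∂μ) ^ (1 / 2 : ℝ)) ^ 2 := by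
        gcongr
    _ = _ := by
        rw [mul_pow, ← ENNReal.rpow_natCast, ← ENNReal.rpow_natCast, ← ENNReal.rpow_mul,
          ← ENNReal.rpow_mul]
        simp

variable [FiniteDimensional ℝ E] [MeasurableSpace E] [BorelSpace E]

/-- On the dual, the rotation preserves the sum of the squared norms of the two restrictions, which
determines the characteristic function. -/
theorem map_pairRotation_stdGaussian (θ : ℝ) :
    ((stdGaussian E).prod (stdGaussian E)).map (pairRotation E θ) =
      (stdGaussian E).prod (stdGaussian E) := by
  have hf : IsFiniteMeasure (((stdGaussian E).prod (stdGaussian E)).map (pairRotation E θ)) :=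
    Measure.isFiniteMeasure_map _ _
  refine Measure.ext_of_charFunDual (funext fun L => ?_)
  rw [charFunDual_map, charFunDual_prod, charFunDual_prod]
  simp_rw [charFunDual_stdGaussian, ← Complex.exp_add]
  congr 1
  have hL : ∀ x y : E, L (x, y) = L (x, 0) + L (0, y) := fun x y => by
    rw [← map_add, Prod.mk_add_mk, add_zero, zero_add]
  have hs : ∀ (c : ℝ) (x : E), L (c • x, 0) = c * L (x, 0) := fun c x => by
    rw [← smul_eq_mul, ← map_smul, Prod.smul_mk, smul_zero]
  have hs' : ∀ (c : ℝ) (x : E), L (0, c • x) = c * L (0, x) := fun c x => by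
    rw [← smul_eq_mul, ← map_smul, Prod.smul_mk, smul_zero]
  have key : ‖(L.comp (pairRotation E θ)).comp (.inl ℝ E E)‖ ^ 2 +
      ‖(L.comp (pairRotation E θ)).comp (.inr ℝ E E)‖ ^ 2 =
      ‖L.comp (.inl ℝ E E)‖ ^ 2 + ‖L.comp (.inr ℝ E E)‖ ^ 2 := by
    simp_rw [(stdOrthonormalBasis ℝ E).norm_dual, ← Finset.sum_add_distrib]
    refine Finset.sum_congr rfl fun i _ => ?_
    simp only [ContinuousLinearMap.comp_apply, ContinuousLinearMap.inl_apply,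
      ContinuousLinearMap.inr_apply, pairRotation_apply, smul_zero, add_zero, zero_add]
    rw [hL, hs, hs', hL (Real.sin θ • _), hs, hs']
    linear_combination (L (stdOrthonormalBasis ℝ E i, 0) ^ 2 +
      L (0, stdOrthonormalBasis ℝ E i) ^ 2) * Real.sin_sq_add_cos_sq θ
  have key' := congrArg (fun r : ℝ => (r : ℂ)) key
  push_cast at key'
  linear_combination (-1 / 2 : ℂ) * key'

theorem lintegral_enorm_dual_sq_stdGaussian (L : StrongDual ℝ E) :
    ∫⁻ x, ‖L x‖ₑ ^ 2 ∂(stdGaussian E) = ‖L‖ₑ ^ 2 := by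
  have hL : MemLp L 2 (stdGaussian E) := IsGaussian.memLp_dual _ L 2 (by simp)
  rw [lintegral_enorm_sq_eq_ofReal hL.integrable_sq, ← ofReal_norm,
    ← ENNReal.ofReal_pow (norm_nonneg _), ← variance_dual_stdGaussian,
    variance_of_integral_eq_zero L.continuous.aemeasurable (integral_strongDual_stdGaussian L)]

open Classical in
/-- The absolute directional derivative of `f` at `p.1` along `p.2`, set to `∞` where `f` is not
differentiable. -/
noncomputable def absDirDeriv (f : E → ℝ) (p : E × E) : ℝ≥0∞ :=
  if DifferentiableAt ℝ f p.1 then ‖fderiv ℝ f p.1 p.2‖ₑ else ∞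

theorem measurable_absDirDeriv (f : E → ℝ) : Measurable (absDirDeriv f) := by
  classical
  refine Measurable.ite (measurable_fst (measurableSet_of_differentiableAt ℝ f)) ?_
    measurable_const
  have h : Measurable fun p : E × E => fderiv ℝ f p.1 p.2 := by
    have hc : Continuous fun q : (E →L[ℝ] ℝ) × E => q.1 q.2 := by fun_prop
    exact hc.measurable.comp (((measurable_fderiv ℝ f).comp measurable_fst).prodMk measurable_snd)
  exact h.enorm

theorem lintegral_absDirDeriv_sq {f : E → ℝ} (hf : LocallyLipschitz f) :
    ∫⁻ p, absDirDeriv f p ^ 2 ∂((stdGaussian E).prod (stdGaussian E)) =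
      ∫⁻ x, ‖fderiv ℝ f x‖ₑ ^ 2 ∂(stdGaussian E) := by
  rw [lintegral_prod _ ((measurable_absDirDeriv f).pow_const 2).aemeasurable]
  refine lintegral_congr_ae ?_
  filter_upwards [hf.ae_differentiableAt_stdGaussian] with x hx
  simp only [absDirDeriv, if_pos hx]
  exact lintegral_enorm_dual_sq_stdGaussian _

/-- The arc `cos θ p.1 + sin θ p.2` joins `p.1` to `p.2`, and its position and velocity are the two
components of `pairRotation E θ p`. Cauchy–Schwarz on an interval of length `π / 2` gives the
factor. -/
theorem enorm_sub_sq_le_lintegral_absDirDeriv {f : E → ℝ} (hf : LocallyLipschitz f) (p : E × E) :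
    ‖f p.1 - f p.2‖ₑ ^ 2 ≤ ENNReal.ofReal (Real.pi / 2) *
      ∫⁻ θ in Ioc 0 (Real.pi / 2), absDirDeriv f (pairRotation E θ p) ^ 2 := by
  have hpi : (0 : ℝ) ≤ Real.pi / 2 := by positivity
  set c : ℝ → E := fun θ => Real.cos θ • p.1 + Real.sin θ • p.2 with hc
  have hcd : ∀ θ, HasDerivAt c (-Real.sin θ • p.1 + Real.cos θ • p.2) θ := fun θ =>
    ((Real.hasDerivAt_cos θ).smul_const _).add ((Real.hasDerivAt_sin θ).smul_const _)
  have hcC : ContDiff ℝ 1 c := by fun_prop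
  have hg : LocallyLipschitz (f ∘ c) := hf.comp hcC.locallyLipschitz
  obtain ⟨K, hK⟩ := hg.locallyLipschitzOn.exists_lipschitzOnWith_of_compact
    (isCompact_uIcc (a := (0 : ℝ)) (b := Real.pi / 2))
  have hftc := hK.absolutelyContinuousOnInterval.integral_deriv_eq_sub
  have hR : Measurable fun θ : ℝ => absDirDeriv f (pairRotation E θ p) := by
    have : Continuous fun θ : ℝ => pairRotation E θ p := by
      simp only [pairRotation_apply]
      fun_prop
    exact (measurable_absDirDeriv f).comp this.measurable
  -- The value `∞` of `absDirDeriv` makes this hold for every `θ`, even if the arc stays where `f`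
  -- is not differentiable.
  have hle : ∀ θ, ‖deriv (f ∘ c) θ‖ₑ ≤ absDirDeriv f (pairRotation E θ p) := by
    intro θ
    by_cases hd : DifferentiableAt ℝ f (c θ)
    · have h1 : HasDerivAt (f ∘ c) (fderiv ℝ f (c θ) (-Real.sin θ • p.1 + Real.cos θ • p.2)) θ :=
        hd.hasFDerivAt.comp_hasDerivAt θ (hcd θ)
      have hd' : DifferentiableAt ℝ f (pairRotation E θ p).1 := hd
      rw [h1.deriv, absDirDeriv, if_pos hd']
      rfl
    · have hd' : ¬DifferentiableAt ℝ f (pairRotation E θ p).1 := hd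
      rw [absDirDeriv, if_neg hd']
      exact le_top
  have hend : ‖f p.1 - f p.2‖ₑ = ‖∫ θ in (0 : ℝ)..(Real.pi / 2), deriv (f ∘ c) θ‖ₑ := by
    rw [hftc, ← enorm_neg]
    simp [hc]
  calc ‖f p.1 - f p.2‖ₑ ^ 2
      ≤ (∫⁻ θ in Ioc 0 (Real.pi / 2), absDirDeriv f (pairRotation E θ p)) ^ 2 := by
        rw [hend, intervalIntegral.integral_of_le hpi]
        gcongr
        exact (enorm_integral_le_lintegral_enorm _).trans (lintegral_mono hle)
    _ ≤ _ := by
        refine (sq_lintegral_le_mul hR.aemeasurable).trans ?_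
        simp

/-- Poincaré inequality for the standard Gaussian measure. -/
theorem lintegral_lintegral_enorm_sub_sq_le {f : E → ℝ} (hf : LocallyLipschitz f) :
    ∫⁻ y, ∫⁻ x, ‖f x - f y‖ₑ ^ 2 ∂(stdGaussian E) ∂(stdGaussian E) ≤
      3 * ∫⁻ x, ‖fderiv ℝ f x‖ₑ ^ 2 ∂(stdGaussian E) := by
  have hm : Measurable fun p : E × E => ‖f p.2 - f p.1‖ₑ ^ 2 := by
    have := hf.continuous
    fun_prop
  have hR : Measurable fun q : (E × E) × ℝ => absDirDeriv f (pairRotation E q.2 q.1) ^ 2 := by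
    have : Continuous fun q : (E × E) × ℝ => pairRotation E q.2 q.1 := by
      simp only [pairRotation_apply]
      fun_prop
    exact ((measurable_absDirDeriv f).comp this.measurable).pow_const 2
  have hpi : (0 : ℝ) ≤ Real.pi / 2 := by positivity
  rw [← lintegral_prod (f := fun p : E × E => ‖f p.2 - f p.1‖ₑ ^ 2) hm.aemeasurable]
  calc ∫⁻ p : E × E, ‖f p.2 - f p.1‖ₑ ^ 2 ∂((stdGaussian E).prod (stdGaussian E))
      ≤ ∫⁻ p, ENNReal.ofReal (Real.pi / 2) * (∫⁻ θ in Ioc 0 (Real.pi / 2),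
          absDirDeriv f (pairRotation E θ p) ^ 2) ∂((stdGaussian E).prod (stdGaussian E)) := by
        refine lintegral_mono fun p => ?_
        rw [← enorm_neg, neg_sub]
        exact enorm_sub_sq_le_lintegral_absDirDeriv hf p
    _ = ENNReal.ofReal (Real.pi / 2) * ∫⁻ θ in Ioc 0 (Real.pi / 2), ∫⁻ p,
          absDirDeriv f (pairRotation E θ p) ^ 2 ∂((stdGaussian E).prod (stdGaussian E)) := by
        rw [lintegral_const_mul _ hR.lintegral_prod_right', lintegral_lintegral_swap]
        exact hR.aemeasurable
    _ = ENNReal.ofReal (Real.pi / 2) * ∫⁻ θ in Ioc 0 (Real.pi / 2),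
          ∫⁻ x, ‖fderiv ℝ f x‖ₑ ^ 2 ∂(stdGaussian E) := by
        -- Rotation invariance makes the inner integral independent of `θ`.
        congr 2 with θ
        rw [← lintegral_absDirDeriv_sq hf]
        conv_rhs => rw [← map_pairRotation_stdGaussian θ]
        rw [lintegral_map ((measurable_absDirDeriv f).pow_const 2) (by fun_prop)]
    _ ≤ _ := by
        rw [lintegral_const, Measure.restrict_apply_univ, Real.volume_Ioc, sub_zero,
          mul_comm (∫⁻ _, _ ∂_), ← mul_assoc, ← ENNReal.ofReal_mul hpi]
        gcongr
        rw [← ENNReal.ofReal_ofNat]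
        refine ENNReal.ofReal_le_ofReal ?_
        -- The constant 3 is a round bound for `(π / 2)²`.
        nlinarith [Real.pi_lt_d2, Real.pi_pos]

end Poincare
-- Comparison of absolute values of operators.
section AbsoluteValue

variable {V W ι : Type*} [NormedAddCommGroup V] [InnerProductSpace ℝ V] [NormedAddCommGroup W]
  [InnerProductSpace ℝ W] [Fintype ι]

/-- Between an eigenvector of `s` and one of `t`, `s² - t²` has entry `σ + τ` times that of `s - t`.
Also `s² - t² = a*(a - b) + (a - b)*b`, while `‖a u‖ = σ` and `‖b v‖ = τ`, so this entry is at most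
`(σ + τ) K`. Dividing by `σ + τ` leaves `K`; if the sum vanishes, so do both eigenvalues and the
entry. -/
theorem abs_inner_sub_le_of_eigenbasis {a b : V →ₗ[ℝ] W} {s t : V →ₗ[ℝ] V} {K : ℝ}
    (hs : s.IsSymmetric) (hsa : ∀ x y, ⟪s x, s y⟫ = ⟪a x, a y⟫)
    (htb : ∀ x y, ⟪t x, t y⟫ = ⟪b x, b y⟫) (hK : ∀ x, ‖a x - b x‖ ≤ K * ‖x‖) {u v : V}
    (hu : ‖u‖ = 1) (hv : ‖v‖ = 1) {σ τ : ℝ} (hσ : 0 ≤ σ) (hτ : 0 ≤ τ) (hsu : s u = σ • u)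
    (htv : t v = τ • v) (ht : t.IsSymmetric) : |⟪u, s v - t v⟫| ≤ K := by
  have hsv : ⟪u, s v⟫ = σ * ⟪u, v⟫ := by rw [← hs u v, hsu, real_inner_smul_left]
  have htv' : ⟪u, t v⟫ = τ * ⟪u, v⟫ := by rw [htv, real_inner_smul_right]
  have e1 : ⟪a u, a v⟫ = σ * (σ * ⟪u, v⟫) := by
    rw [← hsa, hsu, real_inner_smul_left, hsv]
  have e2 : ⟪b u, b v⟫ = τ * (τ * ⟪u, v⟫) := by
    rw [← htb, htv, real_inner_smul_right, ht u v, htv']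
  have hau : ‖a u‖ = σ := by
    have h : ‖a u‖ ^ 2 = σ ^ 2 := by
      rw [← real_inner_self_eq_norm_sq, ← hsa, hsu, real_inner_self_eq_norm_sq, norm_smul, hu,
        mul_one, Real.norm_eq_abs, sq_abs]
    exact (pow_left_inj₀ (norm_nonneg _) hσ two_ne_zero).1 h
  have hbv : ‖b v‖ = τ := by
    have h : ‖b v‖ ^ 2 = τ ^ 2 := by
      rw [← real_inner_self_eq_norm_sq, ← htb, htv, real_inner_self_eq_norm_sq, norm_smul, hv,
        mul_one, Real.norm_eq_abs, sq_abs]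
    exact (pow_left_inj₀ (norm_nonneg _) hτ two_ne_zero).1 h
  have hdu := hK u
  have hdv := hK v
  rw [hu, mul_one] at hdu
  rw [hv, mul_one] at hdv
  have hK0 : 0 ≤ K := (norm_nonneg _).trans hdu
  have e3 : (σ + τ) * ⟪u, s v - t v⟫ = ⟪a u, a v - b v⟫ + ⟪a u - b u, b v⟫ := by
    rw [inner_sub_right, inner_sub_right, inner_sub_left, hsv, htv', e1, e2]
    ring
  have e4 : |(σ + τ) * ⟪u, s v - t v⟫| ≤ (σ + τ) * K := by
    rw [e3]
    refine (abs_add_le _ _).trans ?_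
    have i1 := (abs_real_inner_le_norm (a u) (a v - b v)).trans
      (mul_le_mul_of_nonneg_left hdv (norm_nonneg _))
    have i2 := (abs_real_inner_le_norm (a u - b u) (b v)).trans
      (mul_le_mul_of_nonneg_right hdu (norm_nonneg _))
    rw [hau] at i1
    rw [hbv] at i2
    linarith
  rcases (add_nonneg hσ hτ).eq_or_lt with h0 | h0
  · obtain ⟨rfl, rfl⟩ : σ = 0 ∧ τ = 0 := ⟨by linarith, by linarith⟩
    rw [inner_sub_right, hsv, htv']
    simpa using hK0
  · rw [abs_mul, abs_of_pos h0] at e4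
    exact le_of_mul_le_mul_left e4 h0

/-- Cauchy–Schwarz in each coordinate costs one factor of the dimension, summing the coordinates
another. The two bases may differ, as needed for the eigenbases of two operators. -/
theorem norm_sq_le_of_abs_inner_le (u v : OrthonormalBasis ι ℝ V) {d : V →ₗ[ℝ] V} {K : ℝ}
    (h : ∀ i j, |⟪u i, d (v j)⟫| ≤ K) (x : V) :
    ‖d x‖ ^ 2 ≤ (Fintype.card ι : ℝ) ^ 2 * K ^ 2 * ‖x‖ ^ 2 := by
  have hi : ∀ i, ⟪u i, d x⟫ ^ 2 ≤ (Fintype.card ι : ℝ) * K ^ 2 * ‖x‖ ^ 2 := by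
    intro i
    have hx : ⟪u i, d x⟫ = ∑ j, ⟪u i, d (v j)⟫ * ⟪v j, x⟫ := by
      conv_lhs => rw [← v.sum_repr' x, map_sum, inner_sum]
      refine Finset.sum_congr rfl fun j _ => ?_
      rw [map_smul, real_inner_smul_right, mul_comm]
    rw [hx, ← v.sum_sq_inner_right x]
    refine (Finset.sum_mul_sq_le_sq_mul_sq _ _ _).trans ?_
    gcongr
    calc ∑ j, ⟪u i, d (v j)⟫ ^ 2 ≤ ∑ _j : ι, K ^ 2 :=
          Finset.sum_le_sum fun j _ => sq_le_sq' (neg_le_of_abs_le (h i j)) (le_of_abs_le (h i j))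
      _ = Fintype.card ι * K ^ 2 := by simp
  calc ‖d x‖ ^ 2 = ∑ i, ⟪u i, d x⟫ ^ 2 := (u.sum_sq_inner_right _).symm
    _ ≤ ∑ _i : ι, (Fintype.card ι : ℝ) * K ^ 2 * ‖x‖ ^ 2 := Finset.sum_le_sum fun i _ => hi i
    _ = _ := by
      simp
      ring

end AbsoluteValue

/-! ### Matrix absolute value and polar decomposition. -/

section MatrixAbs

variable {m n : Type*} [Fintype m] [Fintype n] [DecidableEq n]

theorem Matrix.inner_toEuclideanLin_transpose [DecidableEq m] (A : Matrix m n ℝ) (x : EuclideanSpace ℝ m)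
    (y : EuclideanSpace ℝ n) :
    ⟪Matrix.toEuclideanLin Aᵀ x, y⟫ = ⟪x, Matrix.toEuclideanLin A y⟫ := by
  rw [← Matrix.conjTranspose_eq_transpose_of_trivial,
    Matrix.toEuclideanLin_conjTranspose_eq_adjoint, LinearMap.adjoint_inner_left]

theorem Matrix.toEuclideanLin_mul_apply [DecidableEq m] {l : Type*} (A : Matrix l m ℝ) (B : Matrix m n ℝ)
    (x : EuclideanSpace ℝ n) : Matrix.toEuclideanLin (A * B) x =
      Matrix.toEuclideanLin A (Matrix.toEuclideanLin B x) := by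
  simp [Matrix.toLpLin_apply]

theorem Matrix.norm_toEuclideanLin_le (A : Matrix m n ℝ) (x : EuclideanSpace ℝ n) :
    ‖Matrix.toEuclideanLin A x‖ ≤ √(∑ i, ∑ k, A i k ^ 2) * ‖x‖ := by
  rw [← Real.sqrt_sq (norm_nonneg x), ← Real.sqrt_mul (by positivity)]
  refine Real.le_sqrt_of_sq_le ?_
  rw [EuclideanSpace.real_norm_sq_eq, EuclideanSpace.real_norm_sq_eq, Finset.sum_mul]
  refine Finset.sum_le_sum fun i _ => ?_
  exact Finset.sum_mul_sq_le_sq_mul_sq _ _ _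

omit [DecidableEq n] in
theorem Matrix.posSemidef_transpose_mul_self (A : Matrix m n ℝ) : (Aᵀ * A).PosSemidef := by
  simpa using Matrix.posSemidef_conjTranspose_mul_self A

theorem Matrix.posSemidef_sqrt_transpose_mul_self (A : Matrix m n ℝ) :
    (CFC.sqrt (Aᵀ * A)).PosSemidef :=
  Matrix.nonneg_iff_posSemidef.1 (CFC.sqrt_nonneg _)

theorem Matrix.isSymmetric_sqrt_transpose_mul_self (A : Matrix m n ℝ) :
    (Matrix.toEuclideanLin (CFC.sqrt (Aᵀ * A))).IsSymmetric :=
  Matrix.isSymmetric_toEuclideanLin_iff.2 A.posSemidef_sqrt_transpose_mul_self.isHermitian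

theorem Matrix.inner_sqrt_transpose_mul_self [DecidableEq m] (A : Matrix m n ℝ) (x y : EuclideanSpace ℝ n) :
    ⟪Matrix.toEuclideanLin (CFC.sqrt (Aᵀ * A)) x, Matrix.toEuclideanLin (CFC.sqrt (Aᵀ * A)) y⟫ =
      ⟪Matrix.toEuclideanLin A x, Matrix.toEuclideanLin A y⟫ := by
  rw [A.isSymmetric_sqrt_transpose_mul_self, ← Matrix.toEuclideanLin_mul_apply,
    CFC.sqrt_mul_sqrt_self _ A.posSemidef_transpose_mul_self.nonneg,
    Matrix.toEuclideanLin_mul_apply, real_inner_comm, Matrix.inner_toEuclideanLin_transpose,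
    real_inner_comm]

theorem Matrix.exists_eigenbasis_sqrt_transpose_mul_self (A : Matrix m n ℝ) :
    ∃ (v : OrthonormalBasis n ℝ (EuclideanSpace ℝ n)) (τ : n → ℝ), (∀ j, 0 ≤ τ j) ∧
      ∀ j, Matrix.toEuclideanLin (CFC.sqrt (Aᵀ * A)) (v j) = τ j • v j := by
  have h := A.posSemidef_sqrt_transpose_mul_self
  refine ⟨h.isHermitian.eigenvectorBasis, h.isHermitian.eigenvalues, h.eigenvalues_nonneg,
    fun j => ?_⟩
  rw [Matrix.toLpLin_apply, h.isHermitian.mulVec_eigenvectorBasis]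
  rfl

/-- The absolute value `A ↦ (Aᵀ A)^{1/2}` is Lipschitz, with a constant depending on the number of
columns only. -/
theorem Matrix.norm_sqrt_sub_sqrt_sq_le [DecidableEq m] (A B : Matrix m n ℝ) (x : EuclideanSpace ℝ n) :
    ‖Matrix.toEuclideanLin (CFC.sqrt (Aᵀ * A)) x -
      Matrix.toEuclideanLin (CFC.sqrt (Bᵀ * B)) x‖ ^ 2 ≤
      (Fintype.card n : ℝ) ^ 2 * (∑ i, ∑ k, (A i k - B i k) ^ 2) * ‖x‖ ^ 2 := by
  obtain ⟨u, σ, hσ, hu⟩ := A.exists_eigenbasis_sqrt_transpose_mul_self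
  obtain ⟨v, τ, hτ, hv⟩ := B.exists_eigenbasis_sqrt_transpose_mul_self
  have h := norm_sq_le_of_abs_inner_le u v (d := Matrix.toEuclideanLin (CFC.sqrt (Aᵀ * A)) -
    Matrix.toEuclideanLin (CFC.sqrt (Bᵀ * B))) (K := √(∑ i, ∑ k, (A - B) i k ^ 2))
    (fun i j => abs_inner_sub_le_of_eigenbasis A.isSymmetric_sqrt_transpose_mul_self
      A.inner_sqrt_transpose_mul_self B.inner_sqrt_transpose_mul_self
      (fun y => by simpa using (A - B).norm_toEuclideanLin_le y) (u.norm_eq_one i)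
      (v.norm_eq_one j) (hσ i) (hτ j) (hu i) (hv j) B.isSymmetric_sqrt_transpose_mul_self) x
  rw [Real.sq_sqrt (by positivity)] at h
  simpa using h

/-- Polar decomposition of a matrix with no more columns than rows. -/
theorem Matrix.exists_orthonormal_toEuclideanLin_transpose_eq {p M : ℕ} (hM : M ≤ p)
    (B : Matrix (Fin p) (Fin M) ℝ) :
    ∃ (q : Fin M → EuclideanSpace ℝ (Fin p)) (v : OrthonormalBasis (Fin M) ℝ
      (EuclideanSpace ℝ (Fin M))), Orthonormal ℝ q ∧ ∀ z, Matrix.toEuclideanLin Bᵀ z =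
        Matrix.toEuclideanLin (CFC.sqrt (Bᵀ * B)) (∑ j, ⟪q j, z⟫ • v j) := by
  obtain ⟨v, τ, hτ, hv⟩ := B.exists_eigenbasis_sqrt_transpose_mul_self
  have horth : ∀ j k, ⟪Matrix.toEuclideanLin B (v j), Matrix.toEuclideanLin B (v k)⟫ =
      τ j * (τ k * ⟪v j, v k⟫) := fun j k => by
    rw [← B.inner_sqrt_transpose_mul_self, hv, hv, real_inner_smul_left, real_inner_smul_right]
  -- The images of the eigenvectors are orthogonal with norms `τ j`. Padded by zeros to length `p`,
  -- they are completed by Gram–Schmidt to an orthonormal basis; where `τ j = 0` the completing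
  -- vector is immaterial.
  set f : Fin p → EuclideanSpace ℝ (Fin p) := fun i =>
    if h : (i : ℕ) < M then Matrix.toEuclideanLin B (v ⟨i, h⟩) else 0 with hf
  have hpair : Pairwise fun i j => ⟪f i, f j⟫ = 0 := by
    intro i j hij
    simp only [hf]
    split_ifs with hi hj
    · rw [horth, v.inner_eq_zero (by simpa [Fin.ext_iff] using hij)]
      ring
    all_goals simp
  set e := InnerProductSpace.gramSchmidtOrthonormalBasis (𝕜 := ℝ) (by simp) f with he
  have hnorm : ∀ j, ‖Matrix.toEuclideanLin B (v j)‖ = τ j := fun j => by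
    have h := horth j j
    rw [real_inner_self_eq_norm_sq, real_inner_self_eq_norm_sq, v.norm_eq_one] at h
    exact (pow_left_inj₀ (norm_nonneg _) (hτ j) two_ne_zero).1 (by rw [h]; ring)
  have hfj : ∀ j : Fin M, f (Fin.castLE hM j) = Matrix.toEuclideanLin B (v j) := fun j => by
    simp [hf]
  have hB : ∀ j : Fin M, Matrix.toEuclideanLin B (v j) = τ j • e (Fin.castLE hM j) := by
    intro j
    by_cases h0 : τ j = 0
    · rw [h0, zero_smul, ← norm_eq_zero, hnorm, h0]
    · have hne : f (Fin.castLE hM j) ≠ 0 := by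
        rw [hfj, ← norm_ne_zero_iff, hnorm]
        exact h0
      rw [he, InnerProductSpace.gramSchmidtOrthonormalBasis_apply_of_orthogonal _ hpair hne, hfj,
        hnorm]
      simp [smul_smul, h0]
  refine ⟨fun j => e (Fin.castLE hM j), v, e.orthonormal.comp _ (Fin.castLE_injective hM),
    fun z => ?_⟩
  refine InnerProductSpace.ext_inner_right_basis v.toBasis fun j => ?_
  rw [OrthonormalBasis.coe_toBasis, Matrix.inner_toEuclideanLin_transpose, hB,
    B.isSymmetric_sqrt_transpose_mul_self, hv, real_inner_smul_right, real_inner_smul_right,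
    sum_inner]
  simp [real_inner_smul_left, v.inner_eq_ite, real_inner_comm z]

end MatrixAbs

/-- The adjoint of the map is isometric, so composing with the map preserves norms of functionals
and hence the characteristic function. -/
theorem map_sum_inner_smul_stdGaussian {E F ι : Type*} [NormedAddCommGroup E]
    [InnerProductSpace ℝ E] [FiniteDimensional ℝ E] [MeasurableSpace E] [BorelSpace E]
    [NormedAddCommGroup F] [InnerProductSpace ℝ F] [FiniteDimensional ℝ F] [MeasurableSpace F]
    [BorelSpace F] [Fintype ι] {q : ι → E} (hq : Orthonormal ℝ q) (v : OrthonormalBasis ι ℝ F) :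
    (stdGaussian E).map (fun z => ∑ j, ⟪q j, z⟫ • v j) = stdGaussian F := by
  set G : E →L[ℝ] F := ∑ j, (innerSL ℝ (q j)).smulRight (v j) with hG
  have hGz : (fun z => ∑ j, ⟪q j, z⟫ • v j) = G := by
    ext z
    simp [hG]
  rw [hGz]
  refine Measure.ext_of_charFunDual (funext fun L => ?_)
  rw [charFunDual_map, charFunDual_stdGaussian, charFunDual_stdGaussian]
  have hL : L.comp G = innerSL ℝ (∑ j, L (v j) • q j) := by
    ext z
    simp [hG, mul_comm]
  have hn : ‖L.comp G‖ ^ 2 = ‖L‖ ^ 2 := by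
    rw [hL, innerSL_apply_norm, v.norm_dual, ← real_inner_self_eq_norm_sq, hq.inner_sum]
    simp [sq]
  rw [← Complex.ofReal_pow, hn, Complex.ofReal_pow]
-- Squared norms as sums of squares in `[0, ∞]`.
section EnormSquares

theorem enorm_sq_eq_sum {ι : Type*} [Fintype ι] (x : EuclideanSpace ℝ ι) :
    ‖x‖ₑ ^ 2 = ∑ i, ‖x i‖ₑ ^ 2 := by
  simp_rw [← ofReal_norm, ← ENNReal.ofReal_pow (norm_nonneg _)]
  rw [EuclideanSpace.norm_sq_eq, ENNReal.ofReal_sum_of_nonneg fun i _ => by positivity]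

theorem Matrix.enorm_sq_eq_sum {m n : Type*} [Fintype m] [Fintype n] (A : Matrix m n ℝ) :
    ‖A‖ₑ ^ 2 = ∑ i, ∑ k, ‖A i k‖ₑ ^ 2 := by
  have h : ‖A‖ ^ 2 = ∑ i, ∑ k, ‖A i k‖ ^ 2 := by
    rw [Matrix.frobenius_norm_def, ← Real.sqrt_eq_rpow, Real.sq_sqrt (by positivity)]
    simp
  rw [← ofReal_norm, ← ENNReal.ofReal_pow (norm_nonneg _), h,
    ENNReal.ofReal_sum_of_nonneg fun i _ => by positivity]
  refine Finset.sum_congr rfl fun i _ => ?_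
  rw [ENNReal.ofReal_sum_of_nonneg fun i _ => by positivity]
  simp_rw [← ofReal_norm, ← ENNReal.ofReal_pow (norm_nonneg _)]

theorem OrthonormalBasis.enorm_sq_dual {E ι : Type*} [Fintype ι] [NormedAddCommGroup E]
    [InnerProductSpace ℝ E] (b : OrthonormalBasis ι ℝ E) (L : StrongDual ℝ E) :
    ‖L‖ₑ ^ 2 = ∑ i, ‖L (b i)‖ₑ ^ 2 := by
  simp_rw [← ofReal_norm, ← ENNReal.ofReal_pow (norm_nonneg _)]
  rw [b.norm_dual, ENNReal.ofReal_sum_of_nonneg fun i _ => by positivity]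
  simp

end EnormSquares

/-! ### Matrix fields, entry by entry. -/

section MatrixField

variable {p M : ℕ} {W : EuclideanSpace ℝ (Fin p) → Matrix (Fin p) (Fin M) ℝ}

theorem LocallyLipschitz.matrix_entry (hW : LocallyLipschitz W) (i : Fin p) (k : Fin M) :
    LocallyLipschitz fun x => W x i k :=
  hW.clm_comp (LinearMap.toContinuousLinearMap (Matrix.entryLinearMap ℝ ℝ i k))

theorem hasFDerivAt_matrix_entry {x : EuclideanSpace ℝ (Fin p)} (hx : DifferentiableAt ℝ W x)
    (i : Fin p) (k : Fin M) : HasFDerivAt (fun y => W y i k)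
      ((LinearMap.toContinuousLinearMap (Matrix.entryLinearMap ℝ ℝ i k)).comp (fderiv ℝ W x)) x :=
  (LinearMap.toContinuousLinearMap (Matrix.entryLinearMap ℝ ℝ i k)).hasFDerivAt.comp x
    hx.hasFDerivAt

theorem partialDeriv_matrix_entry {x : EuclideanSpace ℝ (Fin p)} (hx : DifferentiableAt ℝ W x)
    (j i : Fin p) (k : Fin M) :
    partialDeriv W j x i k =
      lineDeriv ℝ (fun y => W y i k) x (EuclideanSpace.basisFun (Fin p) ℝ j) := by
  rw [partialDeriv, hx.lineDeriv_eq_fderiv,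
    ((hasFDerivAt_matrix_entry hx i k).hasLineDerivAt _).lineDeriv]
  simp
  rfl

theorem matrixFieldDiv_apply {x : EuclideanSpace ℝ (Fin p)} (hx : DifferentiableAt ℝ W x)
    (k : Fin M) : matrixFieldDiv W x k =
      ∑ j, lineDeriv ℝ (fun y => W y j k) x (EuclideanSpace.basisFun (Fin p) ℝ j) := by
  rw [matrixFieldDiv, WithLp.ofLp_sum, Finset.sum_apply]
  refine Finset.sum_congr rfl fun j _ => ?_
  set T : Matrix (Fin p) (Fin M) ℝ →ₗ[ℝ] EuclideanSpace ℝ (Fin M) :=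
    { toFun := fun A => Matrix.toEuclideanLin Aᵀ (EuclideanSpace.single j (1 : ℝ))
      map_add' := fun A B => by simp
      map_smul' := fun c A => by simp } with hT
  have h : HasFDerivAt (fun y => Matrix.toEuclideanLin (W y)ᵀ (EuclideanSpace.single j (1 : ℝ)))
      ((LinearMap.toContinuousLinearMap T).comp (fderiv ℝ W x)) x :=
    (LinearMap.toContinuousLinearMap T).hasFDerivAt.comp x hx.hasFDerivAt
  rw [partialDeriv, (h.hasLineDerivAt _).lineDeriv,
    ((hasFDerivAt_matrix_entry hx j k).hasLineDerivAt _).lineDeriv]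
  simp [hT, Matrix.toLpLin_apply]

/-- Both sides sum the second moments of all entrywise partial derivatives; the scalar estimates use
gradients of entries. -/
theorem sum_lintegral_enorm_partialDeriv (hW : LocallyLipschitz W) :
    ∑ j, ∫⁻ x, ‖partialDeriv W j x‖ₑ ^ 2 ∂(stdGaussian (EuclideanSpace ℝ (Fin p))) =
      ∑ i, ∑ k, ∫⁻ x, ‖fderiv ℝ (fun y => W y i k) x‖ₑ ^ 2
        ∂(stdGaussian (EuclideanSpace ℝ (Fin p))) := by
  have hm : ∀ i k v, Measurable fun x => ‖lineDeriv ℝ (fun y => W y i k) x v‖ₑ ^ 2 :=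
    fun i k v => (measurable_lineDeriv (hW.matrix_entry i k).continuous).enorm.pow_const 2
  have h1 : ∀ j, ∫⁻ x, ‖partialDeriv W j x‖ₑ ^ 2 ∂(stdGaussian (EuclideanSpace ℝ (Fin p))) =
      ∑ i, ∑ k, ∫⁻ x, ‖lineDeriv ℝ (fun y => W y i k) x (EuclideanSpace.basisFun (Fin p) ℝ j)‖ₑ ^ 2
        ∂(stdGaussian (EuclideanSpace ℝ (Fin p))) := by
    intro j
    simp_rw [← lintegral_finsetSum _ fun k _ => hm _ k _]
    rw [← lintegral_finsetSum _ fun i _ => Finset.measurable_fun_sum _ fun k _ => hm i k _]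
    refine lintegral_congr_ae ?_
    filter_upwards [hW.ae_differentiableAt_stdGaussian] with x hx
    rw [Matrix.enorm_sq_eq_sum]
    simp_rw [partialDeriv_matrix_entry hx]
  have h2 : ∀ i k, ∫⁻ x, ‖fderiv ℝ (fun y => W y i k) x‖ₑ ^ 2
      ∂(stdGaussian (EuclideanSpace ℝ (Fin p))) =
      ∑ j, ∫⁻ x, ‖lineDeriv ℝ (fun y => W y i k) x (EuclideanSpace.basisFun (Fin p) ℝ j)‖ₑ ^ 2
        ∂(stdGaussian (EuclideanSpace ℝ (Fin p))) := by
    intro i k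
    rw [← lintegral_finsetSum _ fun j _ => hm i k _]
    refine lintegral_congr_ae ?_
    filter_upwards [(hW.matrix_entry i k).ae_differentiableAt_stdGaussian] with x hx
    rw [(EuclideanSpace.basisFun (Fin p) ℝ).enorm_sq_dual]
    simp_rw [hx.lineDeriv_eq_fderiv]
  simp_rw [h1, h2]
  rw [Finset.sum_comm]
  exact Finset.sum_congr rfl fun i _ => Finset.sum_comm

/-- Some value of the field approximates it within its Dirichlet energy. -/
theorem exists_sum_lintegral_sub_le (hW : LocallyLipschitz W) :
    ∃ y, ∑ i, ∑ k, ∫⁻ x, ‖W x i k - W y i k‖ₑ ^ 2 ∂(stdGaussian (EuclideanSpace ℝ (Fin p))) ≤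
      3 * ∑ i, ∑ k, ∫⁻ x, ‖fderiv ℝ (fun y => W y i k) x‖ₑ ^ 2
        ∂(stdGaussian (EuclideanSpace ℝ (Fin p))) := by
  have hm : ∀ i k, Measurable fun y =>
      ∫⁻ x, ‖W x i k - W y i k‖ₑ ^ 2 ∂(stdGaussian (EuclideanSpace ℝ (Fin p))) := by
    intro i k
    have hc := (hW.matrix_entry i k).continuous
    have : Measurable fun q : EuclideanSpace ℝ (Fin p) × EuclideanSpace ℝ (Fin p) =>
        ‖W q.2 i k - W q.1 i k‖ₑ ^ 2 := by
      have h1 := (hc.comp continuous_snd).sub (hc.comp continuous_fst)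
      exact h1.measurable.enorm.pow_const 2
    exact this.lintegral_prod_right'
  have hms : Measurable fun y => ∑ i, ∑ k,
      ∫⁻ x, ‖W x i k - W y i k‖ₑ ^ 2 ∂(stdGaussian (EuclideanSpace ℝ (Fin p))) :=
    Finset.measurable_fun_sum _ fun i _ => Finset.measurable_fun_sum _ fun k _ => hm i k
  -- A function is somewhere at most its mean, and the mean is bounded by Poincaré. Centring at a
  -- value of `W` rather than at its expectation needs no integrability.
  obtain ⟨y, hy⟩ := exists_le_lintegral (μ := stdGaussian (EuclideanSpace ℝ (Fin p)))
    hms.aemeasurable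
  refine ⟨y, hy.trans ?_⟩
  rw [lintegral_finsetSum _ fun i _ => Finset.measurable_fun_sum _ fun k _ => hm i k,
    Finset.mul_sum]
  refine Finset.sum_le_sum fun i _ => ?_
  rw [lintegral_finsetSum _ fun k _ => hm i k, Finset.mul_sum]
  exact Finset.sum_le_sum fun k _ => lintegral_lintegral_enorm_sub_sq_le (hW.matrix_entry i k)

/-- Subtracting the constant `W y` does not change the divergence. -/
theorem toEuclideanLin_sub_matrixFieldDiv_apply {x : EuclideanSpace ℝ (Fin p)}
    (hx : DifferentiableAt ℝ W x) (y : EuclideanSpace ℝ (Fin p)) (k : Fin M) :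
    (Matrix.toEuclideanLin (W x - W y)ᵀ x - matrixFieldDiv W x) k =
      ∑ i, gaussianDiv (fun x => W x i k - W y i k) (EuclideanSpace.basisFun (Fin p) ℝ i) x := by
  rw [PiLp.sub_apply, matrixFieldDiv_apply hx, Matrix.toLpLin_apply]
  simp only [Matrix.mulVec, dotProduct, Matrix.transpose_apply, Matrix.sub_apply]
  rw [← Finset.sum_sub_distrib]
  refine Finset.sum_congr rfl fun i _ => ?_
  have hl : lineDeriv ℝ (fun x => W x i k - W y i k) x (EuclideanSpace.basisFun (Fin p) ℝ i) =
      lineDeriv ℝ (fun x => W x i k) x (EuclideanSpace.basisFun (Fin p) ℝ i) := by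
    simp [lineDeriv]
  rw [gaussianDiv, hl, EuclideanSpace.basisFun_inner]
  ring

theorem enorm_sq_sqrt_sub_sqrt_le (A B : Matrix (Fin p) (Fin M) ℝ)
    (x : EuclideanSpace ℝ (Fin M)) :
    ‖Matrix.toEuclideanLin (CFC.sqrt (Aᵀ * A)) x -
      Matrix.toEuclideanLin (CFC.sqrt (Bᵀ * B)) x‖ₑ ^ 2 ≤
      (M : ℝ≥0∞) ^ 2 * (∑ i, ∑ k, ‖A i k - B i k‖ₑ ^ 2) * ‖x‖ₑ ^ 2 := by
  have h := ENNReal.ofReal_le_ofReal (A.norm_sqrt_sub_sqrt_sq_le B x)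
  rw [ENNReal.ofReal_mul (by positivity), ENNReal.ofReal_mul (by positivity),
    ENNReal.ofReal_sum_of_nonneg fun i _ => by positivity] at h
  simp_rw [ENNReal.ofReal_sum_of_nonneg fun _ _ => sq_nonneg (_ : ℝ)] at h
  have e : ∀ r : ℝ, ‖r‖ₑ ^ 2 = ENNReal.ofReal (r ^ 2) := fun r => by
    rw [Real.enorm_eq_ofReal_abs, ← ENNReal.ofReal_pow (abs_nonneg _), sq_abs]
  simp_rw [e]
  simpa [ENNReal.ofReal_pow, ofReal_norm] using h

end MatrixField

/-! ### Assembly of the bounds. -/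

theorem lintegral_divergence_sub_sqrt_le {p M : ℕ}
    {W : EuclideanSpace ℝ (Fin p) → Matrix (Fin p) (Fin M) ℝ} (hW : LocallyLipschitz W)
    (y : EuclideanSpace ℝ (Fin p)) {q : Fin M → EuclideanSpace ℝ (Fin p)} (hq : Orthonormal ℝ q) :
    ∫⁻ x, (2 * ∑ k, ‖∑ i, gaussianDiv (fun x => W x i k - W y i k)
        (EuclideanSpace.basisFun (Fin p) ℝ i) x‖ₑ ^ 2 +
      2 * ((M : ℝ≥0∞) ^ 2 * ∑ l, ∑ i, ∑ k, ‖W x i k - W y i k‖ₑ ^ 2 * ‖⟪q l, x⟫‖ₑ ^ 2))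
        ∂(stdGaussian (EuclideanSpace ℝ (Fin p))) ≤
      (6 + 20 * (M : ℝ≥0∞) ^ 3) * ∑ i, ∑ k, ∫⁻ x, ‖W x i k - W y i k‖ₑ ^ 2
        ∂(stdGaussian (EuclideanSpace ℝ (Fin p))) +
      (4 + 16 * (M : ℝ≥0∞) ^ 3) * ∑ i, ∑ k, ∫⁻ x, ‖fderiv ℝ (fun y => W y i k) x‖ₑ ^ 2
        ∂(stdGaussian (EuclideanSpace ℝ (Fin p))) := by
  have hf : ∀ i k, LocallyLipschitz fun x => W x i k - W y i k := fun i k =>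
    (LipschitzWith.id.sub (LipschitzWith.const _)).locallyLipschitz.comp (hW.matrix_entry i k)
  have hfd : ∀ i k x, fderiv ℝ (fun x => W x i k - W y i k) x = fderiv ℝ (fun y => W y i k) x :=
    fun i k x => fderiv_sub_const _
  have hm1 : ∀ k, Measurable fun x => ‖∑ i, gaussianDiv (fun x => W x i k - W y i k)
      (EuclideanSpace.basisFun (Fin p) ℝ i) x‖ₑ ^ 2 := fun k => by
    refine (Finset.measurable_fun_sum _ fun i _ => ?_).enorm.pow_const 2
    unfold gaussianDiv
    refine Measurable.sub (Measurable.mul (by fun_prop) (hf i k).continuous.measurable)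
      (measurable_lineDeriv (hf i k).continuous)
  have hm2 : ∀ l i k, Measurable fun x : EuclideanSpace ℝ (Fin p) =>
      ‖W x i k - W y i k‖ₑ ^ 2 * ‖⟪q l, x⟫‖ₑ ^ 2 := fun l i k =>
    ((hf i k).continuous.measurable.enorm.pow_const 2).mul (by fun_prop)
  have hm2k := fun l i => Finset.measurable_fun_sum Finset.univ fun k _ => hm2 l i k
  have hm2i := fun l => Finset.measurable_fun_sum Finset.univ fun i _ => hm2k l i
  have hm2l := Finset.measurable_fun_sum Finset.univ fun l _ => hm2i l
  rw [lintegral_add_left ((Finset.measurable_fun_sum _ fun k _ => hm1 k).const_mul 2),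
    lintegral_const_mul _ (Finset.measurable_fun_sum _ fun k _ => hm1 k),
    lintegral_const_mul _ (hm2l.const_mul _), lintegral_const_mul _ hm2l,
    lintegral_finsetSum _ fun k _ => hm1 k, lintegral_finsetSum _ fun l _ => hm2i l]
  simp_rw [lintegral_finsetSum _ fun i _ => hm2k _ i, lintegral_finsetSum _ fun k _ => hm2 _ _ k]
  have b1 := fun k => lintegral_sum_gaussianDiv_le (EuclideanSpace.basisFun (Fin p) ℝ)
    fun i => hf i k
  have b2 := fun l i k => lintegral_enorm_sq_mul_inner_le (hf i k) (hq.1 l)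
  simp_rw [hfd] at b1 b2
  set a := fun i k => ∫⁻ x, ‖W x i k - W y i k‖ₑ ^ 2 ∂(stdGaussian (EuclideanSpace ℝ (Fin p)))
  set d := fun i k => ∫⁻ x, ‖fderiv ℝ (fun y => W y i k) x‖ₑ ^ 2
    ∂(stdGaussian (EuclideanSpace ℝ (Fin p)))
  -- The sum over the `M` vectors `q l` raises the Lipschitz factor `M²` to `M³`.
  calc _ ≤ 2 * ∑ k, ∑ i, (3 * a i k + 2 * d i k) +
        2 * ((M : ℝ≥0∞) ^ 2 * ∑ _l : Fin M, ∑ i, ∑ k, (10 * a i k + 8 * d i k)) := by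
        refine add_le_add (mul_le_mul_right (Finset.sum_le_sum fun k _ => b1 k) _)
          (mul_le_mul_right (mul_le_mul_right (Finset.sum_le_sum fun l _ =>
            Finset.sum_le_sum fun i _ => Finset.sum_le_sum fun k _ => b2 l i k) _) _)
    _ = _ := by
        rw [Finset.sum_comm, Finset.sum_const, Finset.card_univ, Fintype.card_fin, nsmul_eq_mul]
        simp_rw [Finset.sum_add_distrib, ← Finset.mul_sum]
        ring

theorem proposition5p1 (M : ℕ) :
    ∃ C : ℝ≥0, ∀ (p : ℕ), M ≤ p →
      ∀ {Ω : Type*} [MeasurableSpace Ω] (P : Measure Ω) [IsProbabilityMeasure P]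
        (z : Ω → EuclideanSpace ℝ (Fin p)),
        HasLaw z (stdGaussian (EuclideanSpace ℝ (Fin p))) P →
      ∀ W : EuclideanSpace ℝ (Fin p) → Matrix (Fin p) (Fin M) ℝ, LocallyLipschitz W →
      ∃ g : Ω → EuclideanSpace ℝ (Fin M),
        HasLaw g (stdGaussian (EuclideanSpace ℝ (Fin M))) P ∧
        ∫⁻ ω, ‖Matrix.toEuclideanLin (W (z ω))ᵀ (z ω) - matrixFieldDiv W (z ω)
            - Matrix.toEuclideanLin (CFC.sqrt ((W (z ω))ᵀ * W (z ω))) (g ω)‖ₑ ^ 2 ∂P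
          ≤ C * ∑ j : Fin p, ∫⁻ ω, ‖partialDeriv W j (z ω)‖ₑ ^ 2 ∂P := by
  -- The constant is `3 (6 + 20 M³) + (4 + 16 M³)`, the 3 coming from Poincaré.
  refine ⟨22 + 76 * (M : ℝ≥0) ^ 3, fun p hM Ω _ P _ z hz W hW => ?_⟩
  obtain ⟨y, hy⟩ := exists_sum_lintegral_sub_le hW
  obtain ⟨q, v, hq, hqv⟩ := (W y).exists_orthonormal_toEuclideanLin_transpose_eq hM
  have hG : HasLaw (fun x => ∑ j, ⟪q j, x⟫ • v j) (stdGaussian (EuclideanSpace ℝ (Fin M)))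
      (stdGaussian (EuclideanSpace ℝ (Fin p))) :=
    ⟨Measurable.aemeasurable (by fun_prop), map_sum_inner_smul_stdGaussian hq v⟩
  refine ⟨fun ω => ∑ j, ⟪q j, z ω⟫ • v j, hG.fun_comp hz, ?_⟩
  -- A measurable majorant of the squared error: only `Ψ` is transferred to the law of `z`, so
  -- measurability of the matrix square root is not needed.
  set Ψ : EuclideanSpace ℝ (Fin p) → ℝ≥0∞ := fun x =>
    2 * ∑ k, ‖∑ i, gaussianDiv (fun x => W x i k - W y i k)
        (EuclideanSpace.basisFun (Fin p) ℝ i) x‖ₑ ^ 2 +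
      2 * ((M : ℝ≥0∞) ^ 2 * ∑ l, ∑ i, ∑ k, ‖W x i k - W y i k‖ₑ ^ 2 * ‖⟪q l, x⟫‖ₑ ^ 2) with hΨ
  have hf : ∀ i k, LocallyLipschitz fun x => W x i k - W y i k := fun i k =>
    (LipschitzWith.id.sub (LipschitzWith.const _)).locallyLipschitz.comp (hW.matrix_entry i k)
  have hΨm : Measurable Ψ := by
    have h1 : ∀ i k, Measurable (gaussianDiv (fun x => W x i k - W y i k)
        (EuclideanSpace.basisFun (Fin p) ℝ i)) := fun i k => by
      unfold gaussianDiv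
      exact Measurable.sub (Measurable.mul (by fun_prop) (hf i k).continuous.measurable)
        (measurable_lineDeriv (hf i k).continuous)
    have h2 := fun i k => (hf i k).continuous.measurable
    fun_prop
  have hle : ∀ᵐ x ∂(stdGaussian (EuclideanSpace ℝ (Fin p))),
      ‖Matrix.toEuclideanLin (W x)ᵀ x - matrixFieldDiv W x -
        Matrix.toEuclideanLin (CFC.sqrt ((W x)ᵀ * W x)) (∑ j, ⟪q j, x⟫ • v j)‖ₑ ^ 2 ≤ Ψ x := by
    filter_upwards [hW.ae_differentiableAt_stdGaussian] with x hx
    have hsplit : Matrix.toEuclideanLin (W x)ᵀ x - matrixFieldDiv W x -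
        Matrix.toEuclideanLin (CFC.sqrt ((W x)ᵀ * W x)) (∑ j, ⟪q j, x⟫ • v j) =
        (Matrix.toEuclideanLin (W x - W y)ᵀ x - matrixFieldDiv W x) +
        -(Matrix.toEuclideanLin (CFC.sqrt ((W x)ᵀ * W x)) (∑ j, ⟪q j, x⟫ • v j) -
          Matrix.toEuclideanLin (CFC.sqrt ((W y)ᵀ * W y)) (∑ j, ⟪q j, x⟫ • v j)) := by
      -- The polar decomposition of `W y` cancels `(W y)ᵀ x` against the square root term.
      rw [← hqv, Matrix.transpose_sub, map_sub, LinearMap.sub_apply]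
      abel
    have hGx : ‖∑ j, ⟪q j, x⟫ • v j‖ₑ ^ 2 = ∑ l, ‖⟪q l, x⟫‖ₑ ^ 2 := by
      rw [← v.repr.enorm_map, enorm_sq_eq_sum]
      refine Finset.sum_congr rfl fun l _ => ?_
      rw [v.repr_apply_apply, inner_sum]
      simp [real_inner_smul_right, v.inner_eq_ite]
    rw [hsplit]
    refine (enorm_add_sq_le _ _).trans ?_
    rw [enorm_neg, enorm_sq_eq_sum]
    simp_rw [toEuclideanLin_sub_matrixFieldDiv_apply hx y]
    rw [hΨ]
    refine add_le_add_right (mul_le_mul_right ((enorm_sq_sqrt_sub_sqrt_le _ _ _).trans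
      (le_of_eq ?_)) 2) _
    rw [hGx, mul_assoc, Finset.mul_sum]
    simp_rw [Finset.sum_mul]
  have hpd : ∀ j, ∫⁻ ω, ‖partialDeriv W j (z ω)‖ₑ ^ 2 ∂P =
      ∫⁻ x, ‖partialDeriv W j x‖ₑ ^ 2 ∂(stdGaussian (EuclideanSpace ℝ (Fin p))) := fun j =>
    hz.lintegral_comp (f := fun x => ‖partialDeriv W j x‖ₑ ^ 2)
      ((stronglyMeasurable_lineDeriv hW.continuous).enorm.pow_const 2).aemeasurable
  simp_rw [hpd]
  rw [sum_lintegral_enorm_partialDeriv hW]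
  calc _ ≤ ∫⁻ ω, Ψ (z ω) ∂P := by
        refine lintegral_mono_ae ?_
        rw [← hz.map_eq] at hle
        exact ae_of_ae_map hz.aemeasurable hle
    _ = ∫⁻ x, Ψ x ∂(stdGaussian (EuclideanSpace ℝ (Fin p))) :=
        hz.lintegral_comp hΨm.aemeasurable
    _ ≤ _ := lintegral_divergence_sub_sqrt_le hW y hq
    _ ≤ _ := by
        refine (add_le_add_left (mul_le_mul_right hy _) _).trans (le_of_eq ?_)
        push_cast
        ring
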